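/- Let $n>1$ be an integer and put $N=4n+1$. On $[-1,1]$ write $\langle f,g\rangle=\int_{-1}^1 f(t)g(t)\,dt$. For $i\ge 2$ let $\phi_i(t)=(1-t^2)\,p_{i-2}(t)$, where $p_j$ is the monic polynomial of degree $j$ orthogonal to all polynomials of lower degree with respect to the weight $(1-t^2)^2$ on $[-1,1]$ (the monic ultraspherical polynomial $p_j^{5/2}$). Let $P$ be the orthogonal projection in $L^2([-1,1])$ onto $\mathrm{span}\{\phi_2,\dots,\phi_N\}$, the space of polynomials of degree at most $N$ that vanish at $\pm1$. Put $r(t)=(I-P)(1+t)$ and $l(t)=r(-t)$. For odd $m\ge1$ let $\bar u_m(t)=1-|t|\,t^{m-1}$ on $[-1,1]$, and for $k$ even, $0\le k<N$, let $u_{N,k}=(I-P)\bar u_{N-k}$. Set $$ w=\alpha\,u_{N,2n+2}+u_{N,4n},\qquad \alpha=(-1)^n\frac{(4n-1)\,(4n)!\,(n+1)!\,(3n)!}{3\,(2n)!\,(2n+1)!\,(2n+2)!\,(2n-1)!}\in\mathbb Q , $$ $$ q_r=r-\frac{\langle r,w\rangle}{\langle w,w\rangle}\,w,\qquad q_l(t)=q_r(-t).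 $$ Define functions on $\mathbb R$, equal to $0$ where not specified, by $\tilde\phi_0(t)=q_r(2t+1)$ for $-1\le t<0$ and $\tilde\phi_0(t)=q_l(2t-1)$ for $0\le t<1$; $\tilde\phi_1(t)=w(2t-1)$ for $0\le t<1$; and $\tilde\phi_j(t)=\phi_j(2t-1)$ for $0\le t<1$, $j=2,\dots,N$. Let $\Phi_N=(\tilde\phi_0,\dots,\tilde\phi_N)$, let $V_0$ be the closed linear span in $L^2(\mathbb R)$ of all integer translates of the $\tilde\phi_j$, and let $V_p=\{f(2^p\,\cdot):f\in V_0\}$ for $p\in\mathbb Z$. Then $\Phi_N$ generates an orthogonal multiresolution analysis: the $\tilde\phi_j$ are compactly supported $L^2$ functions, $V_p\subset V_{p+1}$ for all $p\in\mathbb Z$, and the integer translates of $\tilde\phi_0,\dots,\tilde\phi_N$ form a Riesz basis of $V_0$ which is also an orthogonal basis of $V_0$. Moreover, $\alpha$ solves the quadratic orthogonality condition $$ a_{1}\alpha^2+2b\,\alpha+a_{2}=0, $$ where, with $u_1=u_{N,2n+2}$ and $u_2=u_{N,4n}$, $a_{i}=\langle u_i,u_i\rangle|\langle r,l\rangle|-\langle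 r,u_i\rangle^2$ and $b=\langle u_1,u_2\rangle|\langle r,l\rangle|-\langle r,u_1\rangle\langle r,u_2\rangle$; equivalently, $\langle r,l\rangle\langle w,w\rangle=\langle r,w\rangle\langle w,l\rangle$. Finally, every $\tilde\phi_j$ is continuous on $\mathbb R$, and on each interval $[k/2,(k+1)/2)$, $k\in\mathbb Z$, it is a polynomial of degree at most $N$ with rational coefficients. -/

import Mathlib

open MeasureTheory

noncomputable section

namespace C0MRA

/-! ### Multiresolution analyses generated by a finite family of functions on the line -/

/-- The integer translates `φ i (· - j)`, as elements of `L²(ℝ)`. -/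
def shifts {ι : Type*} (φ : ι → ℝ → ℝ) (h : ∀ i, MemLp (φ i) 2 (volume : Measure ℝ)) :
    ι × ℤ → Lp ℝ 2 (volume : Measure ℝ) := fun k =>
  ((h k.1).comp_measurePreserving
    (measurePreserving_sub_right (volume : Measure ℝ) (k.2 : ℝ))).toLp

/-- `V₀`: the `L²`-closure of the span of the integer translates of the generators. -/
def V₀ {ι : Type*} (φ : ι → ℝ → ℝ) (h : ∀ i, MemLp (φ i) 2 (volume : Measure ℝ)) :
    Submodule ℝ (Lp ℝ 2 (volume : Measure ℝ)) :=
  (Submodule.span ℝ (Set.range (shifts φ h))).topologicalClosure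

/-- `V_p = {f(2^p ·) : f ∈ V₀}`, for every integer `p`. -/
def V {ι : Type*} (φ : ι → ℝ → ℝ) (h : ∀ i, MemLp (φ i) 2 (volume : Measure ℝ)) (p : ℤ) :
    Set (Lp ℝ 2 (volume : Measure ℝ)) :=
  {g | ∃ f ∈ V₀ φ h, g =ᵐ[volume] fun t : ℝ => f ((2 : ℝ) ^ p * t)}

/-- `e` is a Riesz basis of the closed subspace `W`. -/
def IsRieszBasis {H κ : Type*} [NormedAddCommGroup H] [InnerProductSpace ℝ H]
    (e : κ → H) (W : Submodule ℝ H) : Prop :=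
  (Submodule.span ℝ (Set.range e)).topologicalClosure = W ∧
  ∃ A B : ℝ, 0 < A ∧ 0 < B ∧ ∀ c : κ →₀ ℝ,
    A * (∑ k ∈ c.support, c k ^ 2) ≤ ‖∑ k ∈ c.support, c k • e k‖ ^ 2 ∧
    ‖∑ k ∈ c.support, c k • e k‖ ^ 2 ≤ B * (∑ k ∈ c.support, c k ^ 2)

/-- `e` is an orthogonal basis of the closed subspace `W`. -/
def IsOrthogonalBasis {H κ : Type*} [NormedAddCommGroup H] [InnerProductSpace ℝ H]
    (e : κ → H) (W : Submodule ℝ H) : Prop :=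
  (Submodule.span ℝ (Set.range e)).topologicalClosure = W ∧
  (∀ k, e k ≠ 0) ∧ Pairwise fun k l => inner ℝ (e k) (e l) = 0

/-- The compactly supported `L²` functions `φ i` generate an orthogonal multiresolution analysis:
the spaces `V_p` are nested, the integer translates of the generators form a Riesz basis of `V₀`,
and they form an orthogonal basis of `V₀`. -/
def GeneratesOrthogonalMRA {ι : Type*} (φ : ι → ℝ → ℝ) : Prop :=
  (∀ i, HasCompactSupport (φ i)) ∧
  ∃ h : ∀ i, MemLp (φ i) 2 (volume : Measure ℝ),
    (∀ p : ℤ, V φ h p ⊆ V φ h (p + 1)) ∧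
    IsRieszBasis (shifts φ h) (V₀ φ h) ∧
    IsOrthogonalBasis (shifts φ h) (V₀ φ h)

/-! ### Functions on `[-1,1]` -/

/-- The inner product of `L²([-1,1])`. -/
def ip (f g : ℝ → ℝ) : ℝ := ∫ t in (-1 : ℝ)..1, f t * g t

/-- Orthogonal projection of `f` onto the line spanned by `w`. -/
def projLine (w f : ℝ → ℝ) : ℝ → ℝ := fun t => ip f w / ip w w * w t

/-- The Pochhammer symbol `(a)_i = a (a+1) ⋯ (a+i-1)`. -/
def poch (a : ℝ) (i : ℕ) : ℝ := ∏ k ∈ Finset.range i, (a + k)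

/-- The monic Jacobi polynomial `p_n^{α,β}`, orthogonal for `(1-t)^α (1+t)^β` on `[-1,1]`,
`p_n^{α,β}(t) = 2^n (α+1)_n / (n+α+β+1)_n · ₂F₁(-n, n+α+β+1; α+1; (1-t)/2)`. -/
def jacobi (α β : ℝ) (n : ℕ) (t : ℝ) : ℝ :=
  2 ^ n * poch (α + 1) n / poch (n + α + β + 1) n *
    ∑ i ∈ Finset.range (n + 1),
      poch (-n) i * poch (n + α + β + 1) i / (poch (α + 1) i * poch 1 i) * ((1 - t) / 2) ^ i

/-- The monic ultraspherical polynomial `p_n^λ`. -/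
def ultraspherical (lam : ℝ) (n : ℕ) (t : ℝ) : ℝ := jacobi (lam - 1 / 2) (lam - 1 / 2) n t

/-- `φ_i(t) = (1-t²) p_{i-2}^{5/2}(t)`, used for `i ≥ 2`. For `2 ≤ i ≤ N` these form an orthogonal
basis of the polynomials of degree at most `N` that vanish at `±1`. -/
def phi (i : ℕ) (t : ℝ) : ℝ := (1 - t ^ 2) * ultraspherical (5 / 2) (i - 2) t

/-- The orthogonal projection `P^N` in `L²([-1,1])` onto the polynomials of degree at most `N` that
vanish at `±1`, expanded in the orthogonal basis `φ_2, …, φ_N`. -/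
def P (N : ℕ) (f : ℝ → ℝ) : ℝ → ℝ := fun t => ∑ i ∈ Finset.Icc 2 N, projLine (phi i) f t

/-- The ramp `r^N = (I - P^N)(1 + t)`. -/
def r (N : ℕ) : ℝ → ℝ := fun t => (1 + t) - P N (fun s => 1 + s) t

/-- The reflected ramp `l^N(t) = r^N(-t)`. -/
def l (N : ℕ) : ℝ → ℝ := fun t => r N (-t)

/-- `ū_m`, for `m ≥ 1`: on `[-1,1]` it is `1 - |t| t^{m-1}` for odd `m` and `t - |t| t^{m-1}` for
even `m`; it vanishes elsewhere. -/
def ubar (m : ℕ) : ℝ → ℝ := fun t =>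
  if t ∈ Set.Icc (-1 : ℝ) 1 then
    (if Odd m then 1 - |t| * t ^ (m - 1) else t - |t| * t ^ (m - 1))
  else 0

/-- `u_{N,k} = (I - P^N) ū_{N-k}`, for `k < N`. -/
def u (N k : ℕ) : ℝ → ℝ := fun t => ubar (N - k) t - P N (ubar (N - k)) t

/-- `w_{N,m,m₁} = α u_{N,2m} + u_{N,2m₁}`. -/
def w (N m m₁ : ℕ) (α : ℝ) : ℝ → ℝ := fun t => α * u N (2 * m) t + u N (2 * m₁) t

/-- The quadratic polynomial in `α` whose vanishing expresses
`⟨(I - P_w) r^N, (I - P_w) l^N⟩ = 0` for `w = α u_{N,2m} + u_{N,2m₁} ≠ 0`. -/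
def orthogonalityQuadratic (N m m₁ : ℕ) (α : ℝ) : ℝ :=
  Matrix.det !![ip (u N (2 * m)) (u N (2 * m)), ip (r N) (u N (2 * m));
      ip (r N) (u N (2 * m)), |ip (r N) (l N)|] * α ^ 2
  + 2 * Matrix.det !![ip (u N (2 * m)) (u N (2 * m₁)), ip (r N) (u N (2 * m₁));
      ip (r N) (u N (2 * m)), |ip (r N) (l N)|] * α
  + Matrix.det !![ip (u N (2 * m₁)) (u N (2 * m₁)), ip (r N) (u N (2 * m₁));
      ip (r N) (u N (2 * m₁)), |ip (r N) (l N)|]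

/-! ### The scaling vector `Φ_{4n+1}` -/

/-- The rational number `α_{n+1,2n}(4n+1)`, for `n ≥ 1`. -/
def alpha (n : ℕ) : ℚ :=
  (-1) ^ n *
    ((4 * (n : ℚ) - 1) * ((4 * n).factorial : ℚ) * ((n + 1).factorial : ℚ)
      * ((3 * n).factorial : ℚ)) /
    (3 * ((2 * n).factorial : ℚ) * ((2 * n + 1).factorial : ℚ) * ((2 * n + 2).factorial : ℚ)
      * ((2 * n - 1).factorial : ℚ))

/-- `w_{4n+1,n+1,2n} = α u_{4n+1,2n+2} + u_{4n+1,4n}` with the above `α`. -/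
def wn (n : ℕ) : ℝ → ℝ := w (4 * n + 1) (n + 1) (2 * n) (alpha n : ℝ)

/-- `q_r = (I - P_w) r^{4n+1}`. -/
def qr (n : ℕ) : ℝ → ℝ := fun t => r (4 * n + 1) t - projLine (wn n) (r (4 * n + 1)) t

/-- `q_l(t) = q_r(-t)`. -/
def ql (n : ℕ) : ℝ → ℝ := fun t => qr n (-t)

open Classical in
/-- The scaling function `φ̃_0`, supported on `[-1,1]`. -/
def scaling0 (n : ℕ) : ℝ → ℝ := fun t =>
  if -1 ≤ t ∧ t < 0 then qr n (2 * t + 1)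
  else if 0 ≤ t ∧ t < 1 then ql n (2 * t - 1)
  else 0

open Classical in
/-- The function `g(2t - 1)` for `0 ≤ t < 1`, and `0` elsewhere. -/
def onUnit (g : ℝ → ℝ) : ℝ → ℝ := fun t => if 0 ≤ t ∧ t < 1 then g (2 * t - 1) else 0

/-- The vector `Φ_{4n+1} = (φ̃_0, …, φ̃_{4n+1})`. -/
def Phi (n : ℕ) (j : Fin (4 * n + 2)) : ℝ → ℝ :=
  if (j : ℕ) = 0 then scaling0 n
  else if (j : ℕ) = 1 then onUnit (wn n)
  else onUnit (phi j)

/-- On each interval `[k/2, (k+1)/2)` the function `f` is a polynomial of degree at most `d` with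
rational coefficients. -/
def HasRationalPieces (d : ℕ) (f : ℝ → ℝ) : Prop :=
  ∀ k : ℤ, ∃ p : Polynomial ℚ, p.natDegree ≤ d ∧
    ∀ t ∈ Set.Ico ((k : ℝ) / 2) (((k : ℝ) + 1) / 2), f t = Polynomial.aeval t p

end C0MRA

end

/-! Put K = 2n+1, so N+1 = 2K. The polynomial r is orthogonal to every polynomial of degree at most
N vanishing at ±1. Hence its even and odd parts are the reproducing kernels at 1, on [0,1], of the
even and of the odd polynomials of degree at most N, scaled to be 1 at 1 (`r_eq`). Their squared
norms are E = 2/(K(2K-1)) and O = 2/(K(2K+1)), so ⟨r,l⟩ = E - O.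

For odd m let M_m be the component of x^m orthogonal to the even monomials up to x^(2K-2). The
Cauchy structure of ⟨x^a,x^b⟩ = 1/(a+b+1) makes all its data explicit: M_m(1) = B_m and ⟨M_m,M_m'⟩ =
B_m B_m'/(m+m'+1), where B_m is a product of the factors (m-2j)/(m+2j+1). Then u_{N,N-m} = B_m·(even
part of r) - M_m(|t|) (`u_eq`), so all inner products in the orthogonality condition are rational
expressions in n, B_1 and B_{2n-1}.

The constant α is exactly what gives 3αB_{2n-1} = -(4n-1)B_1 (`alpha_mul_blaschke`). Both sides of
⟨r,l⟩⟨w,w⟩ = ⟨r,w⟩² then become the same multiple of (n-1)²B_1² (`ip_r_l_mul_ip_wn`). For n > 1 this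
also shows w ≠ 0. Since w is even, the identity says that q_r and q_l are orthogonal.

On one unit interval the translates restrict to q_l, q_r, w and the φ_i, which are pairwise
orthogonal; this gives the orthogonal basis and, as only finitely many norms occur, the Riesz
bounds. For nestedness, each generator dilated by 2 is continuous and piecewise polynomial with
integer knots. Subtracting translates of the first generator that match its values at the integers
leaves, on each unit interval, a combination of the φ_i and w (`mem_translateSpan`). Rationality
holds because every projection coefficient is a quotient of integrals of rational polynomials. -/

noncomputable section

namespace C0MRA

open Polynomial

section Muntz

/-! ### Orthogonalising monomials on `[0,1]` -/

/-- The product `∏_{j<k} (a - c_j) / (a + c_j + 1)`. -/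
def blaschke (c : ℕ → ℕ) (k a : ℕ) : ℝ :=
  ∏ j ∈ Finset.range k, ((a : ℝ) - c j) / ((a : ℝ) + c j + 1)

/-- The component of `X ^ a` orthogonal to `X ^ c_j`, `j < k`, in `L²([0,1])`. -/
def muntz (c : ℕ → ℕ) : ℕ → ℕ → ℝ[X]
  | 0, a => X ^ a
  | k + 1, a => muntz c k a -
      C (blaschke c k a * (2 * c k + 1) / ((a + c k + 1) * blaschke c k (c k))) * muntz c k (c k)

/-- The reproducing kernel at `1` of the span of `X ^ c_j`, `j < k`, in `L²([0,1])`. -/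
def kernelOne (c : ℕ → ℕ) : ℕ → ℝ[X]
  | 0 => 0
  | k + 1 => kernelOne c k + C ((2 * c k + 1) / blaschke c k (c k)) * muntz c k (c k)

/-- The span of `X ^ c_j`, `j < k`. -/
def monoSpan (c : ℕ → ℕ) (k : ℕ) : Submodule ℝ ℝ[X] :=
  Submodule.span ℝ ((fun j => X ^ c j) '' Set.Iio k)

variable {c : ℕ → ℕ}

lemma blaschke_succ (k a : ℕ) :
    blaschke c (k + 1) a = blaschke c k a * (((a : ℝ) - c k) / ((a : ℝ) + c k + 1)) :=
  Finset.prod_range_succ _ _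

lemma blaschke_node {k j : ℕ} (h : j < k) : blaschke c k (c j) = 0 :=
  Finset.prod_eq_zero (Finset.mem_range.2 h) (by simp)

lemma blaschke_ne_zero {k a : ℕ} (h : ∀ j < k, a ≠ c j) : blaschke c k a ≠ 0 := by
  refine Finset.prod_ne_zero_iff.2 fun j hj => div_ne_zero ?_ (by positivity)
  have := h j (Finset.mem_range.1 hj)
  rw [sub_ne_zero]
  exact_mod_cast this

lemma blaschke_next_ne_zero (hc : Function.Injective c) (k : ℕ) : blaschke c k (c k) ≠ 0 :=
  blaschke_ne_zero fun _ hj h => hj.ne (hc h).symm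

lemma intervalIntegrable_eval_mul (p q : ℝ[X]) (a b : ℝ) :
    IntervalIntegrable (fun t => p.eval t * q.eval t) volume a b :=
  (by fun_prop : Continuous fun t => p.eval t * q.eval t).intervalIntegrable _ _

/-- The inner product of `L²([0,1])` on polynomials. -/
def unitForm : ℝ[X] →ₗ[ℝ] ℝ[X] →ₗ[ℝ] ℝ :=
  LinearMap.mk₂ ℝ (fun p q => ∫ t in (0 : ℝ)..1, p.eval t * q.eval t)
    (fun p p' q => by
      simp only [eval_add, add_mul]
      exact intervalIntegral.integral_add (intervalIntegrable_eval_mul ..)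
        (intervalIntegrable_eval_mul ..))
    (fun a p q => by simp [mul_assoc])
    (fun p q q' => by
      simp only [eval_add, mul_add]
      exact intervalIntegral.integral_add (intervalIntegrable_eval_mul ..)
        (intervalIntegrable_eval_mul ..))
    (fun a p q => by simp [mul_left_comm])

lemma unitForm_apply (p q : ℝ[X]) :
    unitForm p q = ∫ t in (0 : ℝ)..1, p.eval t * q.eval t := rfl

lemma unitForm_comm (p q : ℝ[X]) : unitForm p q = unitForm q p := by
  simp only [unitForm_apply, mul_comm]

lemma unitForm_X_pow (a b : ℕ) : unitForm (X ^ a) (X ^ b) = 1 / ((a : ℝ) + b + 1) := by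
  simp [unitForm_apply, ← pow_add, integral_pow]

/-- A Schur complement of a Cauchy matrix is again of Cauchy type. With c = c_k the inductive step
is 1/(a+b+1) - (2c+1)/((a+c+1)(b+c+1)) = (a-c)(b-c)/((a+b+1)(a+c+1)(b+c+1)). The factor at b = c_j
vanishes, which is the orthogonality that `muntz` is built for. -/
lemma unitForm_muntz_X_pow (hc : Function.Injective c) (k a b : ℕ) :
    unitForm (muntz c k a) (X ^ b) = blaschke c k a * blaschke c k b / ((a : ℝ) + b + 1) := by
  induction k generalizing a b with
  | zero => simp [muntz, unitForm_X_pow, blaschke]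
  | succ k ih =>
    have h := blaschke_next_ne_zero hc k
    have h1 : (a : ℝ) + c k + 1 ≠ 0 := by positivity
    have h2 : (b : ℝ) + c k + 1 ≠ 0 := by positivity
    have h3 : (c k : ℝ) + b + 1 ≠ 0 := by positivity
    have h4 : (a : ℝ) + b + 1 ≠ 0 := by positivity
    rw [muntz, C_mul', map_sub, LinearMap.sub_apply, map_smul, LinearMap.smul_apply, ih, ih,
      blaschke_succ, blaschke_succ, smul_eq_mul]
    field_simp
    ring

lemma muntz_eval_one (hc : Function.Injective c) (k a : ℕ) :
    (muntz c k a).eval 1 = blaschke c k a := by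
  induction k generalizing a with
  | zero => simp [muntz, blaschke]
  | succ k ih =>
    have h := blaschke_next_ne_zero hc k
    have h1 : (a : ℝ) + c k + 1 ≠ 0 := by positivity
    rw [muntz, eval_sub, eval_mul, eval_C, ih, ih, blaschke_succ]
    field_simp
    ring

/-- The kernel is the sum of m(1)·m/‖m‖² over the orthogonal vectors m = `muntz c k (c k)`, and the
pairings with X ^ b telescope. At a node b = c_j the right side is 1, the value of X ^ b at 1, hence
the reproducing property. -/
lemma unitForm_kernelOne_X_pow (hc : Function.Injective c) (k b : ℕ) :
    unitForm (kernelOne c k) (X ^ b) = 1 - blaschke c k b := by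
  induction k with
  | zero => simp [kernelOne, blaschke]
  | succ k ih =>
    have h := blaschke_next_ne_zero hc k
    have h2 : (b : ℝ) + c k + 1 ≠ 0 := by positivity
    have h3 : (c k : ℝ) + b + 1 ≠ 0 := by positivity
    rw [kernelOne, C_mul', map_add, LinearMap.add_apply, map_smul, LinearMap.smul_apply, ih,
      unitForm_muntz_X_pow hc, blaschke_succ, smul_eq_mul]
    field_simp
    ring

lemma kernelOne_eval_one (hc : Function.Injective c) (k : ℕ) :
    (kernelOne c k).eval 1 = ∑ j ∈ Finset.range k, (2 * (c j : ℝ) + 1) := by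
  induction k with
  | zero => simp [kernelOne]
  | succ k ih =>
    have h := blaschke_next_ne_zero hc k
    rw [kernelOne, eval_add, eval_mul, eval_C, ih, muntz_eval_one hc, Finset.sum_range_succ]
    field_simp

lemma monoSpan_mono {k l : ℕ} (h : k ≤ l) : monoSpan c k ≤ monoSpan c l :=
  Submodule.span_mono (Set.image_mono (Set.Iio_subset_Iio h))

lemma X_pow_mem_monoSpan {j k : ℕ} (h : j < k) : (X ^ c j : ℝ[X]) ∈ monoSpan c k :=
  Submodule.subset_span ⟨j, h, rfl⟩

lemma X_pow_sub_muntz_mem (k a : ℕ) : X ^ a - muntz c k a ∈ monoSpan c k := by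
  induction k generalizing a with
  | zero => simp [muntz]
  | succ k ih =>
    have h : muntz c k (c k) ∈ monoSpan c (k + 1) := by
      have := sub_mem (X_pow_mem_monoSpan (c := c) k.lt_succ_self)
        (monoSpan_mono k.le_succ (ih (c k)))
      rwa [sub_sub_cancel] at this
    rw [muntz, C_mul', ← sub_add]
    exact add_mem (monoSpan_mono k.le_succ (ih a)) (Submodule.smul_mem _ _ h)

lemma kernelOne_mem (k : ℕ) : kernelOne c k ∈ monoSpan c k := by
  induction k with
  | zero => simp [kernelOne]
  | succ k ih =>
    have h : muntz c k (c k) ∈ monoSpan c (k + 1) := by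
      have := sub_mem (X_pow_mem_monoSpan (c := c) k.lt_succ_self)
        (monoSpan_mono k.le_succ (X_pow_sub_muntz_mem k (c k)))
      rwa [sub_sub_cancel] at this
    rw [kernelOne, C_mul']
    exact add_mem (monoSpan_mono k.le_succ ih) (Submodule.smul_mem _ _ h)

lemma unitForm_muntz_of_mem (hc : Function.Injective c) {k : ℕ} (a : ℕ) {p : ℝ[X]}
    (hp : p ∈ monoSpan c k) : unitForm (muntz c k a) p = 0 := by
  induction hp using Submodule.span_induction with
  | mem x hx =>
    obtain ⟨j, hj, rfl⟩ := hx
    simp [unitForm_muntz_X_pow hc, blaschke_node hj]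
  | zero => simp
  | add x y _ _ hx hy => simp [hx, hy]
  | smul r x _ hx => simp [hx]

lemma unitForm_kernelOne_of_mem (hc : Function.Injective c) {k : ℕ} {p : ℝ[X]}
    (hp : p ∈ monoSpan c k) : unitForm (kernelOne c k) p = p.eval 1 := by
  induction hp using Submodule.span_induction with
  | mem x hx =>
    obtain ⟨j, hj, rfl⟩ := hx
    simp [unitForm_kernelOne_X_pow hc, blaschke_node hj]
  | zero => simp
  | add x y _ _ hx hy => simp [hx, hy]
  | smul r x _ hx => simp [hx]

lemma unitForm_muntz_muntz (hc : Function.Injective c) (k a b : ℕ) :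
    unitForm (muntz c k a) (muntz c k b) =
      blaschke c k a * blaschke c k b / ((a : ℝ) + b + 1) := by
  rw [← unitForm_muntz_X_pow hc, ← sub_eq_zero, ← map_sub, ← neg_sub, map_neg,
    unitForm_muntz_of_mem hc a (X_pow_sub_muntz_mem k b), neg_zero]

/-! ### The inner product of `L²([-1,1])` -/

lemma ip_comm (f g : ℝ → ℝ) : ip f g = ip g f := by simp only [ip, mul_comm]

lemma ip_congr {f f' g g' : ℝ → ℝ} (hf : Set.EqOn f f' (Set.Icc (-1) 1))
    (hg : Set.EqOn g g' (Set.Icc (-1) 1)) : ip f g = ip f' g' := by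
  refine intervalIntegral.integral_congr fun t ht => ?_
  rw [Set.uIcc_of_le (by norm_num)] at ht
  simp only [hf ht, hg ht]

lemma ip_add_left {f f' g : ℝ → ℝ} (hf : Continuous f) (hf' : Continuous f')
    (hg : Continuous g) : ip (fun t => f t + f' t) g = ip f g + ip f' g := by
  simp only [ip, add_mul]
  exact intervalIntegral.integral_add ((hf.mul hg).intervalIntegrable _ _)
    ((hf'.mul hg).intervalIntegrable _ _)

lemma ip_sub_left {f f' g : ℝ → ℝ} (hf : Continuous f) (hf' : Continuous f')
    (hg : Continuous g) : ip (fun t => f t - f' t) g = ip f g - ip f' g := by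
  simp only [ip, sub_mul]
  exact intervalIntegral.integral_sub ((hf.mul hg).intervalIntegrable _ _)
    ((hf'.mul hg).intervalIntegrable _ _)

lemma ip_smul_left (a : ℝ) (f g : ℝ → ℝ) : ip (fun t => a * f t) g = a * ip f g := by
  simp only [ip, mul_assoc, intervalIntegral.integral_const_mul]

lemma ip_add_right {f f' g : ℝ → ℝ} (hf : Continuous f) (hf' : Continuous f')
    (hg : Continuous g) : ip g (fun t => f t + f' t) = ip g f + ip g f' := by
  simp only [ip_comm g, ip_add_left hf hf' hg]

lemma ip_sub_right {f f' g : ℝ → ℝ} (hf : Continuous f) (hf' : Continuous f')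
    (hg : Continuous g) : ip g (fun t => f t - f' t) = ip g f - ip g f' := by
  simp only [ip_comm g, ip_sub_left hf hf' hg]

lemma ip_smul_right (a : ℝ) (f g : ℝ → ℝ) : ip g (fun t => a * f t) = a * ip g f := by
  simp only [ip_comm g, ip_smul_left]

lemma ip_sum_left {ι : Type*} (s : Finset ι) {f : ι → ℝ → ℝ} {g : ℝ → ℝ}
    (hf : ∀ i, Continuous (f i)) (hg : Continuous g) :
    ip (fun t => ∑ i ∈ s, f i t) g = ∑ i ∈ s, ip (f i) g := by
  simp only [ip, Finset.sum_mul]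
  exact intervalIntegral.integral_finsetSum fun i _ => ((hf i).mul hg).intervalIntegrable _ _

lemma ip_comp_neg (f g : ℝ → ℝ) : ip (fun t => f (-t)) (fun t => g (-t)) = ip f g := by
  have := intervalIntegral.integral_comp_neg (a := -1) (b := 1) fun t => f t * g t
  simpa [ip] using this

lemma ip_eq_zero_of_even_of_odd {f g : ℝ → ℝ} (hf : ∀ t, f (-t) = f t) (hg : ∀ t, g (-t) = -g t) :
    ip f g = 0 := by
  have h := ip_comp_neg f g
  simp only [hf, hg, ip, mul_neg, intervalIntegral.integral_neg] at h
  rw [ip]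
  linarith

lemma ip_eq_two_mul {f g : ℝ → ℝ} (hf : Continuous f) (hg : Continuous g)
    (h : ∀ t, f (-t) * g (-t) = f t * g t) : ip f g = 2 * ∫ t in (0 : ℝ)..1, f t * g t := by
  have hi : Continuous fun t => f t * g t := hf.mul hg
  rw [ip, ← intervalIntegral.integral_add_adjacent_intervals (hi.intervalIntegrable (-1) 0)
    (hi.intervalIntegrable 0 1)]
  have := intervalIntegral.integral_comp_neg (a := 0) (b := 1) fun t => f t * g t
  simp only [h, neg_zero] at this
  rw [← this]
  ring

lemma ip_eval_abs (p q : ℝ[X]) :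
    ip (fun t => p.eval |t|) (fun t => q.eval |t|) = 2 * unitForm p q := by
  rw [ip_eq_two_mul (by fun_prop) (by fun_prop) (by simp), unitForm_apply]
  congr 1
  refine intervalIntegral.integral_congr fun t ht => ?_
  rw [Set.uIcc_of_le (by norm_num)] at ht
  simp only [abs_of_nonneg ht.1]

lemma ip_eval_of_odd {p q : ℝ[X]} (hp : ∀ t, p.eval (-t) = -p.eval t)
    (hq : ∀ t, q.eval (-t) = -q.eval t) :
    ip (fun t => p.eval t) (fun t => q.eval t) = 2 * unitForm p q := by
  rw [ip_eq_two_mul (by fun_prop) (by fun_prop) (by simp [hp, hq]), unitForm_apply]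

end Muntz

section Ultraspherical

/-! ### The polynomials `φ_i` -/

/-- The rational Pochhammer symbol. -/
def ratPoch (a : ℚ) (i : ℕ) : ℚ := ∏ k ∈ Finset.range i, (a + k)

lemma ratPoch_cast (a : ℚ) (i : ℕ) : ((ratPoch a i : ℚ) : ℝ) = poch (a : ℝ) i := by
  simp [ratPoch, poch]

lemma ratPoch_succ (a : ℚ) (i : ℕ) : ratPoch a (i + 1) = ratPoch a i * (a + i) :=
  Finset.prod_range_succ _ _

lemma ratPoch_pos {a : ℚ} (ha : 0 < a) (i : ℕ) : 0 < ratPoch a i :=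
  Finset.prod_pos fun _ _ => by positivity

lemma ratPoch_neg_of_lt {n i : ℕ} (h : n < i) : ratPoch (-n) i = 0 :=
  Finset.prod_eq_zero (Finset.mem_range.2 h) (by simp)

lemma ratPoch_neg_ne_zero {n i : ℕ} (h : i ≤ n) : ratPoch (-n) i ≠ 0 := by
  refine Finset.prod_ne_zero_iff.2 fun j hj => ?_
  have : (j : ℚ) < n := by exact_mod_cast (Finset.mem_range.1 hj).trans_le h
  linarith

/-- The coefficients of `₂F₁(-n, n+5; 3; x)`. -/
def hyperCoeff (n i : ℕ) : ℚ :=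
  ratPoch (-n) i * ratPoch (n + 5) i / (ratPoch 3 i * ratPoch 1 i)

/-- The polynomial `₂F₁(-n, n+5; 3; x)`. -/
def hyper (n : ℕ) : ℚ[X] := ∑ i ∈ Finset.range (n + 1), C (hyperCoeff n i) * X ^ i

lemma hyper_coeff (n i : ℕ) : (hyper n).coeff i = hyperCoeff n i := by
  simp only [hyper, finsetSum_coeff, coeff_C_mul, coeff_X_pow, mul_ite, mul_one, mul_zero,
    Finset.sum_ite_eq, Finset.mem_range]
  split_ifs with h
  · rfl
  · rw [hyperCoeff, ratPoch_neg_of_lt (by omega)]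
    simp

lemma hyperCoeff_succ (n i : ℕ) :
    ((i : ℚ) + 1) * (i + 3) * hyperCoeff n (i + 1) = ((i : ℚ) - n) * (i + n + 5) *
      hyperCoeff n i := by
  have h1 := (ratPoch_pos (a := 3) (by norm_num) i).ne'
  have h2 := (ratPoch_pos (a := 1) (by norm_num) i).ne'
  simp only [hyperCoeff, ratPoch_succ]
  have h3 : (3 : ℚ) + i ≠ 0 := by positivity
  have h4 : (1 : ℚ) + i ≠ 0 := by positivity
  field_simp
  ring

/-- Comparing coefficients reduces the hypergeometric equation to the two-term recurrence
`hyperCoeff_succ`; the coefficients 0 and 1 are separate because multiplying by X shifts indices. -/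
lemma hyper_ode (n : ℕ) :
    X * (1 - X) * derivative (derivative (hyper n)) + 3 * (1 - 2 * X) * derivative (hyper n)
      + C ((n : ℚ) * (n + 5)) * hyper n = 0 := by
  have e : X * (1 - X) * derivative (derivative (hyper n))
      + 3 * (1 - 2 * X) * derivative (hyper n) + C ((n : ℚ) * (n + 5)) * hyper n =
      X * derivative (derivative (hyper n)) - X * (X * derivative (derivative (hyper n)))
      + C 3 * derivative (hyper n) - C 6 * (X * derivative (hyper n))
      + C ((n : ℚ) * (n + 5)) * hyper n := by
    simp only [map_ofNat]
    ring
  rw [e]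
  ext m
  have key := hyperCoeff_succ n m
  rcases m with _ | _ | m
  · simp only [coeff_add, coeff_sub, coeff_C_mul, coeff_derivative, hyper_coeff,
      coeff_X_mul_zero, coeff_zero]
    push_cast at key ⊢
    linear_combination key
  · simp only [coeff_add, coeff_sub, coeff_C_mul, coeff_derivative, hyper_coeff,
      coeff_X_mul_zero, coeff_zero, coeff_X_mul]
    push_cast at key ⊢
    linear_combination key
  · simp only [coeff_add, coeff_sub, coeff_C_mul, coeff_derivative, hyper_coeff,
      coeff_zero, coeff_X_mul]
    push_cast at key ⊢
    linear_combination key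

lemma hyper_natDegree (n : ℕ) : (hyper n).natDegree = n := by
  refine natDegree_eq_of_le_of_coeff_ne_zero ?_ ?_
  · rw [natDegree_le_iff_coeff_eq_zero]
    intro i hi
    rw [hyper_coeff, hyperCoeff, ratPoch_neg_of_lt hi]
    simp
  · rw [hyper_coeff, hyperCoeff]
    exact div_ne_zero (mul_ne_zero (ratPoch_neg_ne_zero le_rfl) (ratPoch_pos (by positivity) _).ne')
      (ne_of_gt (mul_pos (ratPoch_pos (by norm_num) _) (ratPoch_pos (by norm_num) _)))

/-- The affine map `t ↦ (1 - t) / 2`. -/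
def halfMap : ℚ[X] := C (1 / 2) * (1 - X)

/-- The monic ultraspherical polynomial of index `5/2`, with rational coefficients. -/
def jacobiPoly (n : ℕ) : ℚ[X] :=
  C (2 ^ n * ratPoch 3 n / ratPoch (n + 5) n) * (hyper n).comp halfMap

/-- The polynomial `φ_i`, with rational coefficients. -/
def phiPoly (i : ℕ) : ℚ[X] := (1 - X ^ 2) * jacobiPoly (i - 2)

/-- The index 5/2 means Jacobi exponents 2 and 2, hence the parameters n + 5 and 3 of the
hypergeometric series. -/
lemma aeval_jacobiPoly (n : ℕ) (t : ℝ) : aeval t (jacobiPoly n) = ultraspherical (5 / 2) n t := by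
  have h1 : ((n : ℝ) + (5 / 2 - 1 / 2) + (5 / 2 - 1 / 2) + 1) = ((n + 5 : ℚ) : ℝ) := by
    push_cast; ring
  have h2 : ((5 : ℝ) / 2 - 1 / 2 + 1) = ((3 : ℚ) : ℝ) := by norm_num
  have h3 : (-(n : ℝ)) = ((-n : ℚ) : ℝ) := by push_cast; ring
  have h5 : ∀ i, poch 1 i = ((ratPoch 1 i : ℚ) : ℝ) := fun i => by rw [ratPoch_cast]; norm_num
  rw [ultraspherical, jacobi, h1, h2, h3]
  simp only [h5, ← ratPoch_cast, jacobiPoly, hyper, halfMap, map_mul, aeval_C, aeval_comp, map_sum,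
    map_pow, aeval_X, map_sub, map_one, hyperCoeff, eq_ratCast]
  push_cast
  congr 1
  refine Finset.sum_congr rfl fun i _ => ?_
  ring

lemma phi_eq_aeval (i : ℕ) (t : ℝ) : phi i t = aeval t (phiPoly i) := by
  simp [phi, phiPoly, aeval_jacobiPoly]

lemma phi_eq_eval (i : ℕ) (t : ℝ) :
    phi i t = ((phiPoly i).map (algebraMap ℚ ℝ)).eval t := by
  rw [phi_eq_aeval, eval_map_algebraMap]

lemma continuous_phi (i : ℕ) : Continuous (phi i) := by
  simp only [funext (phi_eq_eval i)]
  fun_prop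

lemma jacobiPoly_natDegree (n : ℕ) : (jacobiPoly n).natDegree = n := by
  have h : halfMap.natDegree = 1 := by
    have : halfMap = C (-1 / 2) * X + C (1 / 2) := by
      simp only [halfMap, neg_div, C_neg]
      ring
    rw [this]
    exact natDegree_linear (by norm_num)
  rw [jacobiPoly, natDegree_C_mul, natDegree_comp, h, hyper_natDegree, mul_one]
  exact div_ne_zero (mul_ne_zero (by positivity) (ratPoch_pos (by norm_num) _).ne')
    (ratPoch_pos (by positivity) _).ne'

lemma jacobiPoly_ne_zero (n : ℕ) : jacobiPoly n ≠ 0 := by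
  rw [jacobiPoly]
  refine mul_ne_zero (C_ne_zero.2 ?_) fun h => ?_
  · exact div_ne_zero (mul_ne_zero (by positivity) (ratPoch_pos (by norm_num) _).ne')
      (ratPoch_pos (by positivity) _).ne'
  · have h2 := congrArg (fun p => p.eval 1) h
    simp only [eval_comp, halfMap, eval_mul, eval_C, eval_sub, eval_one, eval_X, sub_self,
      mul_zero, eval_zero] at h2
    rw [← coeff_zero_eq_eval_zero, hyper_coeff] at h2
    simp [hyperCoeff, ratPoch] at h2

lemma one_sub_X_sq_ne_zero {R : Type*} [CommRing R] [Nontrivial R] : (1 - X ^ 2 : R[X]) ≠ 0 := by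
  intro h
  have := congrArg (fun p => p.coeff 0) h
  simp at this

lemma natDegree_one_sub_X_sq {R : Type*} [CommRing R] [Nontrivial R] :
    (1 - X ^ 2 : R[X]).natDegree = 2 := by
  rw [← natDegree_neg, neg_sub]
  exact natDegree_X_pow_sub_C (n := 2) (r := (1 : R))

lemma phiPoly_ne_zero (i : ℕ) : phiPoly i ≠ 0 :=
  mul_ne_zero one_sub_X_sq_ne_zero (jacobiPoly_ne_zero _)

lemma phiPoly_natDegree {i : ℕ} (hi : 2 ≤ i) : (phiPoly i).natDegree = i := by
  rw [phiPoly, natDegree_mul one_sub_X_sq_ne_zero (jacobiPoly_ne_zero _), natDegree_one_sub_X_sq,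
    jacobiPoly_natDegree]
  omega

lemma jacobiPoly_ode (n : ℕ) :
    (1 - X ^ 2) * derivative (derivative (jacobiPoly n)) - 6 * X * derivative (jacobiPoly n)
      + C ((n : ℚ) * (n + 5)) * jacobiPoly n = 0 := by
  have h := congrArg (fun p : ℚ[X] => p.comp halfMap) (hyper_ode n)
  have hd : derivative halfMap = C (-1 / 2) := by
    simp [halfMap, neg_div]
  have hC : (C (1 / 2) : ℚ[X]) * 2 = 1 := by
    rw [← map_ofNat C, ← C_mul]
    norm_num
  have hC' : (C (-1 / 2) : ℚ[X]) = - C (1 / 2) := by rw [← C_neg, neg_div]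
  simp only [add_comp, mul_comp, sub_comp, X_comp, C_comp, one_comp, zero_comp, ofNat_comp] at h
  simp only [jacobiPoly, derivative_comp, derivative_mul, hd, derivative_C,
    zero_mul, zero_add]
  simp only [hC']
  set k := (C (2 ^ n * ratPoch 3 n / ratPoch (n + 5) n) : ℚ[X])
  set F0 := (hyper n).comp halfMap
  set F1 := (derivative (hyper n)).comp halfMap
  set F2 := (derivative (derivative (hyper n))).comp halfMap
  simp only [halfMap] at h
  set e := (C (1 / 2) : ℚ[X])
  -- Each derivative in t brings out a factor -1/2 from x = (1-t)/2, and x(1-x) = (1-t²)/4; the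
  -- multiples of `hC` absorb the surplus products 2·(1/2).
  linear_combination k * h + (e * (1 - X) * F2 * k + 3 * k * F1) * hC

/-- A primitive of the product of two of the `φ_i`, by the differential equation. -/
def wronskian (i j : ℕ) : ℚ[X] :=
  (1 - X ^ 2) ^ 3 *
    (derivative (jacobiPoly i) * jacobiPoly j - jacobiPoly i * derivative (jacobiPoly j))

lemma derivative_wronskian (i j : ℕ) :
    derivative (wronskian i j) = C ((j : ℚ) * (j + 5) - i * (i + 5)) *
      (((1 - X ^ 2) * jacobiPoly i) * ((1 - X ^ 2) * jacobiPoly j)) := by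
  have hi := jacobiPoly_ode i
  have hj := jacobiPoly_ode j
  simp only [wronskian, derivative_mul, derivative_sub, derivative_pow, derivative_one,
    derivative_X, C_sub, Nat.cast_ofNat, map_ofNat]
  linear_combination (1 - X ^ 2) ^ 2 * jacobiPoly j * hi - (1 - X ^ 2) ^ 2 * jacobiPoly i * hj

/-- Sturm–Liouville argument: the product of the two functions, times the difference of the
eigenvalues i(i+5), is the derivative of `wronskian`, which vanishes at ±1 through the factor
(1-t²)³. The eigenvalues are distinct. -/
lemma ip_phi_phi {i j : ℕ} (hi : 2 ≤ i) (hj : 2 ≤ j) (hij : i ≠ j) : ip (phi i) (phi j) = 0 := by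
  obtain ⟨i, rfl⟩ := Nat.exists_eq_add_of_le' hi
  obtain ⟨j, rfl⟩ := Nat.exists_eq_add_of_le' hj
  have h := intervalIntegral.integral_eq_sub_of_hasDerivAt (a := -1) (b := 1)
    (f := fun t => aeval t (wronskian i j))
    (f' := fun t => aeval t (derivative (wronskian i j)))
    (fun t _ => (wronskian i j).hasDerivAt_aeval t)
    ((Polynomial.continuous_aeval _).intervalIntegrable _ _)
  have h0 : ((j : ℝ) * (j + 5) - i * (i + 5)) ≠ 0 := by
    have e : ((j : ℝ) * (j + 5) - i * (i + 5)) = (j - i) * (j + i + 5) := by ring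
    rw [e]
    refine mul_ne_zero (sub_ne_zero.2 ?_) (by positivity)
    norm_cast
    omega
  have h1 : (fun t : ℝ => aeval t (derivative (wronskian i j))) =
      fun t => ((j : ℝ) * (j + 5) - i * (i + 5)) * (phi (i + 2) t * phi (j + 2) t) := by
    funext t
    simp [derivative_wronskian, phi_eq_aeval, phiPoly]
  rw [h1, intervalIntegral.integral_const_mul] at h
  have h2 : ∀ s : ℝ, s ^ 2 = 1 → aeval s (wronskian i j) = 0 := fun s hs => by
    simp [wronskian, hs]
  rw [h2 1 (by norm_num), h2 (-1) (by norm_num), sub_zero] at h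
  exact (mul_eq_zero.1 h).resolve_left h0

lemma ip_self_pos_of_polynomial {p : ℝ[X]} (hp : p ≠ 0) :
    0 < ip (fun t => p.eval t) (fun t => p.eval t) := by
  obtain ⟨s, hs, hps⟩ : ∃ s ∈ Set.Icc (-1 : ℝ) 1, p.eval s ≠ 0 := by
    by_contra! h
    exact hp (p.eq_zero_of_infinite_isRoot
      ((Set.Icc_infinite (by norm_num : (-1 : ℝ) < 1)).mono h))
  refine intervalIntegral.integral_pos (by norm_num) (by fun_prop)
    (fun t _ => mul_self_nonneg _) ⟨s, hs, mul_self_pos.2 hps⟩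

lemma ip_phi_self_pos (i : ℕ) : 0 < ip (phi i) (phi i) := by
  simp only [funext (phi_eq_eval i)]
  exact ip_self_pos_of_polynomial
    ((Polynomial.map_ne_zero_iff (algebraMap ℚ ℝ).injective).2 (phiPoly_ne_zero i))

/-- A sequence of polynomials of the right degrees spans the polynomials. -/
lemma exists_sum_of_natDegree_eq {K : Type*} [Field K] {y : ℕ → K[X]} (hy : ∀ j, y j ≠ 0)
    (hd : ∀ j, (y j).natDegree = j) (d : ℕ) (q : K[X]) (hq : q.degree < d) :
    ∃ a : ℕ → K, q = ∑ j ∈ Finset.range d, C (a j) * y j := by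
  induction d generalizing q with
  | zero =>
    refine ⟨0, ?_⟩
    simpa using hq
  | succ d ih =>
    have hl : (y d).coeff d ≠ 0 := by
      have := leadingCoeff_ne_zero.2 (hy d)
      rwa [leadingCoeff, hd] at this
    obtain ⟨a, ha⟩ := ih (q - C (q.coeff d / (y d).coeff d) * y d) (by
      rw [degree_lt_iff_coeff_zero] at hq ⊢
      intro m hm
      rcases hm.eq_or_lt with rfl | hm
      · simp [hl]
      · have : (y d).coeff m = 0 := coeff_eq_zero_of_natDegree_lt (by rw [hd]; exact hm)
        rw [coeff_sub, coeff_C_mul, hq m hm, this]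
        simp)
    refine ⟨Function.update a d (q.coeff d / (y d).coeff d), ?_⟩
    rw [Finset.sum_range_succ, Function.update_self]
    have : ∑ j ∈ Finset.range d, C (Function.update a d (q.coeff d / (y d).coeff d) j) * y j =
        ∑ j ∈ Finset.range d, C (a j) * y j :=
      Finset.sum_congr rfl fun j hj => by
        rw [Function.update_of_ne (Finset.mem_range.1 hj).ne]
    rw [this, ← ha]
    ring

/-- Vanishing at ±1 means divisibility by 1 - X², and the quotient expands in the Jacobi polynomials
because they have every degree once. -/
lemma exists_eq_sum_phi {N : ℕ} (hN : 2 ≤ N) {g : ℝ[X]} (hg : g.natDegree ≤ N)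
    (h1 : g.eval 1 = 0) (h2 : g.eval (-1) = 0) :
    ∃ a : ℕ → ℝ, ∀ t, g.eval t = ∑ i ∈ Finset.Icc 2 N, a i * phi i t := by
  have hdvd : (1 - X ^ 2 : ℝ[X]) ∣ g := by
    have e : (1 - X ^ 2 : ℝ[X]) = -((X - C 1) * (X - C (-1))) := by
      simp only [map_one, map_neg]
      ring
    rw [e, neg_dvd]
    refine IsCoprime.mul_dvd (isCoprime_X_sub_C_of_isUnit_sub ?_) (dvd_iff_isRoot.2 h1)
      (dvd_iff_isRoot.2 h2)
    norm_num
  obtain ⟨q, rfl⟩ := hdvd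
  have hq : q.degree < (N - 1 : ℕ) := by
    by_cases hq0 : q = 0
    · simp [hq0]
    · rw [natDegree_mul one_sub_X_sq_ne_zero hq0, natDegree_one_sub_X_sq] at hg
      rw [degree_eq_natDegree hq0]
      exact_mod_cast (by omega : q.natDegree < N - 1)
  obtain ⟨a, rfl⟩ := exists_sum_of_natDegree_eq
    (y := fun j => (jacobiPoly j).map (algebraMap ℚ ℝ))
    (fun j => (Polynomial.map_ne_zero_iff (algebraMap ℚ ℝ).injective).2 (jacobiPoly_ne_zero j))
    (fun j => by rw [natDegree_map, jacobiPoly_natDegree]) (N - 1) q hq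
  refine ⟨fun i => a (i - 2), fun t => ?_⟩
  have e : Finset.Icc 2 N = Finset.Ico 2 (N + 1) := by ext; simp
  rw [e, Finset.sum_Ico_eq_sum_range, show N + 1 - 2 = N - 1 by omega, eval_mul, eval_finsetSum,
    Finset.mul_sum]
  refine Finset.sum_congr rfl fun j _ => ?_
  simp [phi_eq_eval, phiPoly]
  ring

/-! ### The orthogonal projection `P N`. -/

lemma P_congr {N : ℕ} {f g : ℝ → ℝ} (h : ∀ i ∈ Finset.Icc 2 N, ip f (phi i) = ip g (phi i)) :
    P N f = P N g := by
  funext t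
  exact Finset.sum_congr rfl fun i hi => by rw [projLine, projLine, h i hi]

/-- `P N` is the orthogonal projection. -/
lemma P_eq {N : ℕ} (hN : 2 ≤ N) {f : ℝ → ℝ} {g : ℝ[X]} (hg : g.natDegree ≤ N)
    (h1 : g.eval 1 = 0) (h2 : g.eval (-1) = 0)
    (h : ∀ i ∈ Finset.Icc 2 N, ip f (phi i) = ip (fun t => g.eval t) (phi i)) (t : ℝ) :
    P N f t = g.eval t := by
  obtain ⟨a, ha⟩ := exists_eq_sum_phi hN hg h1 h2
  rw [P_congr h, ha t]
  refine Finset.sum_congr rfl fun i hi => ?_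
  rw [projLine]
  have : ip (fun t => g.eval t) (phi i) = a i * ip (phi i) (phi i) := by
    simp only [ha]
    rw [ip_sum_left _ (fun i => (continuous_phi i).const_mul (a i)) (continuous_phi i)]
    simp only [ip_smul_left]
    refine Finset.sum_eq_single_of_mem i hi fun j hj hji => ?_
    rw [ip_phi_phi (Finset.mem_Icc.1 hj).1 (Finset.mem_Icc.1 hi).1 hji, mul_zero]
  rw [this, mul_div_cancel_right₀ _ (ip_phi_self_pos i).ne']

lemma ip_sub_P_phi {N i : ℕ} (hi : i ∈ Finset.Icc 2 N) {f : ℝ → ℝ} (hf : Continuous f) :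
    ip (fun t => f t - P N f t) (phi i) = 0 := by
  have hc : ∀ j, Continuous (projLine (phi j) f) := fun j => (continuous_phi j).const_mul _
  have hP : Continuous (P N f) := continuous_finsetSum _ fun j _ => hc j
  rw [ip_sub_left hf hP (continuous_phi i)]
  unfold P
  rw [ip_sum_left _ hc (continuous_phi i), Finset.sum_eq_single_of_mem i hi]
  · unfold projLine
    rw [ip_smul_left, div_mul_cancel₀ _ (ip_phi_self_pos i).ne', sub_self]
  · intro j hj hji
    unfold projLine
    rw [ip_smul_left, ip_phi_phi (Finset.mem_Icc.1 hj).1 (Finset.mem_Icc.1 hi).1 hji, mul_zero]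

end Ultraspherical

section ClosedForms

/-! ### Closed forms of the ramp and of the functions `u_{N,k}` -/

/-- The even exponents. -/
def evenNode (j : ℕ) : ℕ := 2 * j

/-- The odd exponents. -/
def oddNode (j : ℕ) : ℕ := 2 * j + 1

lemma evenNode_injective : Function.Injective evenNode := fun a b h => by
  simp only [evenNode] at h; omega

lemma oddNode_injective : Function.Injective oddNode := fun a b h => by
  simp only [oddNode] at h; omega

lemma natDegree_le_of_mem_monoSpan {c : ℕ → ℕ} {k N : ℕ} (h : ∀ j < k, c j ≤ N) {p : ℝ[X]}
    (hp : p ∈ monoSpan c k) : p.natDegree ≤ N := by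
  rw [natDegree_le_iff_degree_le, ← mem_degreeLE]
  refine Submodule.span_le.2 ?_ hp
  rintro _ ⟨j, hj, rfl⟩
  exact mem_degreeLE.2 ((degree_X_pow_le _).trans (by exact_mod_cast h j hj))

lemma eval_neg_of_mem_even {k : ℕ} {p : ℝ[X]} (hp : p ∈ monoSpan evenNode k) (t : ℝ) :
    p.eval (-t) = p.eval t := by
  induction hp using Submodule.span_induction with
  | mem x hx =>
    obtain ⟨j, -, rfl⟩ := hx
    simp [evenNode, pow_mul]
  | zero => simp
  | add x y _ _ hx hy => simp [hx, hy]
  | smul r x _ hx => simp [hx]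

lemma eval_abs_of_mem_even {k : ℕ} {p : ℝ[X]} (hp : p ∈ monoSpan evenNode k) (t : ℝ) :
    p.eval |t| = p.eval t := by
  rcases abs_choice t with h | h <;> rw [h]
  exact eval_neg_of_mem_even hp t

lemma eval_neg_of_mem_odd {k : ℕ} {p : ℝ[X]} (hp : p ∈ monoSpan oddNode k) (t : ℝ) :
    p.eval (-t) = -p.eval t := by
  induction hp using Submodule.span_induction with
  | mem x hx =>
    obtain ⟨j, -, rfl⟩ := hx
    simp [oddNode, pow_succ, pow_mul]
  | zero => simp
  | add x y _ _ hx hy =>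
    simp only [eval_add, hx, hy]
    ring
  | smul r x _ hx => simp [hx]

lemma exists_even_add_odd {N K : ℕ} (hK : N + 1 = 2 * K) {p : ℝ[X]} (hp : p.natDegree ≤ N) :
    ∃ a ∈ monoSpan evenNode K, ∃ b ∈ monoSpan oddNode K, p = a + b := by
  have : p ∈ monoSpan evenNode K ⊔ monoSpan oddNode K := by
    have h : p ∈ degreeLT ℝ (N + 1) := by
      rw [mem_degreeLT]
      exact degree_le_natDegree.trans_lt (by exact_mod_cast Nat.lt_succ_of_le hp)
    rw [degreeLT_eq_span_X_pow] at h
    refine Submodule.span_le.2 ?_ h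
    intro q hq
    simp only [Finset.coe_image, Set.mem_image, Finset.coe_range, Set.mem_Iio] at hq
    obtain ⟨i, hi, rfl⟩ := hq
    rcases Nat.even_or_odd' i with ⟨j, rfl | rfl⟩
    · exact Submodule.mem_sup_left (X_pow_mem_monoSpan (c := evenNode) (by omega))
    · exact Submodule.mem_sup_right (X_pow_mem_monoSpan (c := oddNode) (by omega))
  obtain ⟨a, ha, b, hb, h⟩ := Submodule.mem_sup.1 this
  exact ⟨a, ha, b, hb, h.symm⟩

/-- The even part of the ramp. -/
def rampEven (K : ℕ) : ℝ[X] := C (((kernelOne evenNode K).eval 1)⁻¹) * kernelOne evenNode K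

/-- The odd part of the ramp. -/
def rampOdd (K : ℕ) : ℝ[X] := C (((kernelOne oddNode K).eval 1)⁻¹) * kernelOne oddNode K

lemma kernelOne_even_eval_one (K : ℕ) :
    (kernelOne evenNode K).eval 1 = (K : ℝ) * (2 * K - 1) := by
  rw [kernelOne_eval_one evenNode_injective]
  induction K with
  | zero => simp
  | succ K ih =>
    rw [Finset.sum_range_succ, ih]
    simp only [evenNode]
    push_cast
    ring

lemma kernelOne_odd_eval_one (K : ℕ) :
    (kernelOne oddNode K).eval 1 = (K : ℝ) * (2 * K + 1) := by
  rw [kernelOne_eval_one oddNode_injective]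
  induction K with
  | zero => simp
  | succ K ih =>
    rw [Finset.sum_range_succ, ih]
    simp only [oddNode]
    push_cast
    ring

lemma rampEven_mem (K : ℕ) : rampEven K ∈ monoSpan evenNode K := by
  rw [rampEven, C_mul']
  exact Submodule.smul_mem _ _ (kernelOne_mem K)

lemma rampOdd_mem (K : ℕ) : rampOdd K ∈ monoSpan oddNode K := by
  rw [rampOdd, C_mul']
  exact Submodule.smul_mem _ _ (kernelOne_mem K)

lemma kernelOne_even_eval_one_ne_zero {K : ℕ} (hK : 1 ≤ K) :
    (kernelOne evenNode K).eval 1 ≠ 0 := by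
  rw [kernelOne_even_eval_one]
  have : (1 : ℝ) ≤ K := by exact_mod_cast hK
  refine mul_ne_zero ?_ ?_ <;> linarith

lemma kernelOne_odd_eval_one_ne_zero {K : ℕ} (hK : 1 ≤ K) :
    (kernelOne oddNode K).eval 1 ≠ 0 := by
  rw [kernelOne_odd_eval_one]
  have : (1 : ℝ) ≤ K := by exact_mod_cast hK
  refine mul_ne_zero ?_ ?_ <;> linarith

lemma rampEven_eval_one {K : ℕ} (hK : 1 ≤ K) : (rampEven K).eval 1 = 1 := by
  rw [rampEven, eval_mul, eval_C, inv_mul_cancel₀ (kernelOne_even_eval_one_ne_zero hK)]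

lemma rampOdd_eval_one {K : ℕ} (hK : 1 ≤ K) : (rampOdd K).eval 1 = 1 := by
  rw [rampOdd, eval_mul, eval_C, inv_mul_cancel₀ (kernelOne_odd_eval_one_ne_zero hK)]

lemma unitForm_rampEven {K : ℕ} {p : ℝ[X]} (hp : p ∈ monoSpan evenNode K) :
    unitForm (rampEven K) p = p.eval 1 / ((K : ℝ) * (2 * K - 1)) := by
  rw [rampEven, C_mul', map_smul, LinearMap.smul_apply,
    unitForm_kernelOne_of_mem evenNode_injective hp, kernelOne_even_eval_one, smul_eq_mul,
    inv_mul_eq_div]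

lemma unitForm_rampOdd {K : ℕ} {p : ℝ[X]} (hp : p ∈ monoSpan oddNode K) :
    unitForm (rampOdd K) p = p.eval 1 / ((K : ℝ) * (2 * K + 1)) := by
  rw [rampOdd, C_mul', map_smul, LinearMap.smul_apply,
    unitForm_kernelOne_of_mem oddNode_injective hp, kernelOne_odd_eval_one, smul_eq_mul,
    inv_mul_eq_div]

/-- Even functions see only the even part of a polynomial. -/
lemma ip_eval_abs_add {K : ℕ} (g : ℝ[X]) {a b : ℝ[X]} (ha : a ∈ monoSpan evenNode K)
    (hb : b ∈ monoSpan oddNode K) :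
    ip (fun t => g.eval |t|) (fun t => (a + b).eval t) = 2 * unitForm g a := by
  simp only [eval_add]
  rw [ip_add_right (by fun_prop) (by fun_prop) (by fun_prop),
    ip_eq_zero_of_even_of_odd (g := fun t => b.eval t) (by simp) (eval_neg_of_mem_odd hb),
    add_zero, ← ip_eval_abs]
  simp only [eval_abs_of_mem_even ha]

lemma ip_odd_add {K : ℕ} {g : ℝ[X]} (hg : g ∈ monoSpan oddNode K) {a b : ℝ[X]}
    (ha : a ∈ monoSpan evenNode K) (hb : b ∈ monoSpan oddNode K) :
    ip (fun t => g.eval t) (fun t => (a + b).eval t) = 2 * unitForm g b := by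
  simp only [eval_add]
  rw [ip_add_right (by fun_prop) (by fun_prop) (by fun_prop), ip_comm _ fun t => a.eval t,
    ip_eq_zero_of_even_of_odd (eval_neg_of_mem_even ha) (eval_neg_of_mem_odd hg),
    zero_add, ip_eval_of_odd (eval_neg_of_mem_odd hg) (eval_neg_of_mem_odd hb)]

lemma exists_even_add_odd_of_roots {N K : ℕ} (hK : N + 1 = 2 * K) {p : ℝ[X]} (hp : p.natDegree ≤ N)
    (h1 : p.eval 1 = 0) (h2 : p.eval (-1) = 0) :
    ∃ a ∈ monoSpan evenNode K, ∃ b ∈ monoSpan oddNode K,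
    p = a + b ∧ a.eval 1 = 0 ∧ b.eval 1 = 0 := by
  obtain ⟨a, ha, b, hb, rfl⟩ := exists_even_add_odd hK hp
  refine ⟨a, ha, b, hb, rfl, ?_⟩
  rw [eval_add] at h1 h2
  rw [eval_neg_of_mem_even ha, eval_neg_of_mem_odd hb] at h2
  constructor <;> linarith

/-- The even part of p vanishes at 1, and pairing with the kernel at 1 only sees that value. -/
lemma ip_rampEven_eq_zero {N K : ℕ} (hK : N + 1 = 2 * K) {p : ℝ[X]} (hp : p.natDegree ≤ N)
    (h1 : p.eval 1 = 0) (h2 : p.eval (-1) = 0) :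
    ip (fun t => (rampEven K).eval t) (fun t => p.eval t) = 0 := by
  obtain ⟨a, ha, b, hb, rfl, ha1, -⟩ := exists_even_add_odd_of_roots hK hp h1 h2
  have := ip_eval_abs_add (rampEven K) ha hb
  simp only [eval_abs_of_mem_even (rampEven_mem K)] at this
  rw [this, unitForm_rampEven ha, ha1]
  simp

lemma ip_rampOdd_eq_zero {N K : ℕ} (hK : N + 1 = 2 * K) {p : ℝ[X]} (hp : p.natDegree ≤ N)
    (h1 : p.eval 1 = 0) (h2 : p.eval (-1) = 0) :
    ip (fun t => (rampOdd K).eval t) (fun t => p.eval t) = 0 := by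
  obtain ⟨a, ha, b, hb, rfl, -, hb1⟩ := exists_even_add_odd_of_roots hK hp h1 h2
  rw [ip_odd_add (rampOdd_mem K) ha hb, unitForm_rampOdd hb, hb1]
  simp

lemma ip_muntz_eq_zero {N K : ℕ} (hK : N + 1 = 2 * K) {p : ℝ[X]} (hp : p.natDegree ≤ N)
    (h1 : p.eval 1 = 0) (h2 : p.eval (-1) = 0) (m : ℕ) :
    ip (fun t => (muntz evenNode K m).eval |t|) (fun t => p.eval t) = 0 := by
  obtain ⟨a, ha, b, hb, rfl, -, -⟩ := exists_even_add_odd_of_roots hK hp h1 h2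
  rw [ip_eval_abs_add _ ha hb, unitForm_muntz_of_mem evenNode_injective m ha, mul_zero]

lemma phi_one (i : ℕ) : phi i 1 = 0 := by simp [phi]

lemma phi_neg_one (i : ℕ) : phi i (-1) = 0 := by simp [phi]

/-- The polynomial projected out of `1 + t`. -/
def rampProj (K : ℕ) : ℝ[X] := 1 + X - rampEven K - rampOdd K

lemma rampProj_natDegree {N K : ℕ} (hK : N + 1 = 2 * K) : (rampProj K).natDegree ≤ N := by
  refine (natDegree_sub_le_of_le (natDegree_sub_le_of_le (natDegree_add_le_of_degree_le ?_ ?_)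
    (natDegree_le_of_mem_monoSpan ?_ (rampEven_mem K)))
    (natDegree_le_of_mem_monoSpan ?_ (rampOdd_mem K))).trans
    (by simp only [max_self, le_refl] : max (max N N) N ≤ N)
  · simp
  · rw [natDegree_X]; omega
  · intro j hj; simp only [evenNode]; omega
  · intro j hj; simp only [oddNode]; omega

/-- The right side is orthogonal to all φ_i and agrees with 1 + t at ±1, so the difference `rampProj
K` has degree at most N, vanishes at ±1 and must be the projection. -/
lemma r_eq {N K : ℕ} (hN : 2 ≤ N) (hK : N + 1 = 2 * K) (t : ℝ) :
    r N t = (rampEven K).eval t + (rampOdd K).eval t := by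
  have hK1 : 1 ≤ K := by omega
  have e : ∀ t, (rampProj K).eval t = (1 + t) - ((rampEven K).eval t + (rampOdd K).eval t) :=
    fun t => by simp only [rampProj, eval_sub, eval_add, eval_one, eval_X]; ring
  have : P N (fun s => 1 + s) t = (rampProj K).eval t := by
    refine P_eq hN (rampProj_natDegree hK) ?_ ?_ ?_ t
    · rw [e, rampEven_eval_one hK1, rampOdd_eval_one hK1]
      norm_num
    · rw [e, eval_neg_of_mem_even (rampEven_mem K), eval_neg_of_mem_odd (rampOdd_mem K),
        rampEven_eval_one hK1, rampOdd_eval_one hK1]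
      norm_num
    · intro i hi
      have hi := Finset.mem_Icc.1 hi
      have hd : ((phiPoly i).map (algebraMap ℚ ℝ)).natDegree ≤ N := by
        rw [natDegree_map, phiPoly_natDegree hi.1]
        exact hi.2
      have h1 : ((phiPoly i).map (algebraMap ℚ ℝ)).eval 1 = 0 := by rw [← phi_eq_eval, phi_one]
      have h2 : ((phiPoly i).map (algebraMap ℚ ℝ)).eval (-1) = 0 := by
        rw [← phi_eq_eval, phi_neg_one]
      simp only [e]
      rw [ip_sub_left (by fun_prop) (by fun_prop) (continuous_phi i),
        ip_add_left (f := fun t => (rampEven K).eval t) (by fun_prop) (by fun_prop)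
          (continuous_phi i)]
      simp only [funext (phi_eq_eval i)]
      rw [ip_rampEven_eq_zero hK hd h1 h2, ip_rampOdd_eq_zero hK hd h1 h2]
      ring
  rw [r, this, e]
  ring

/-- The polynomial projected out of `1 - |t| ^ m`. -/
def bumpProj (K m : ℕ) : ℝ[X] :=
  1 - (X ^ m - muntz evenNode K m) - C (blaschke evenNode K m) * rampEven K

lemma bumpProj_natDegree {N K : ℕ} (hK : N + 1 = 2 * K) (m : ℕ) :
    (bumpProj K m).natDegree ≤ N := by
  have h : ∀ j < K, evenNode j ≤ N := fun j hj => by simp only [evenNode]; omega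
  refine (natDegree_sub_le_of_le (natDegree_sub_le_of_le (m := N) ?_
    (natDegree_le_of_mem_monoSpan h (X_pow_sub_muntz_mem K m)))
    (natDegree_le_of_mem_monoSpan h ?_)).trans
    (by simp only [max_self, le_refl] : max (max N N) N ≤ N)
  · simp
  · rw [C_mul']
    exact Submodule.smul_mem _ _ (rampEven_mem K)

lemma ubar_eq {m : ℕ} (hm : Odd m) (t : ℝ) (ht : t ∈ Set.Icc (-1 : ℝ) 1) :
    ubar m t = 1 - |t| ^ m := by
  obtain ⟨j, rfl⟩ := hm
  rw [ubar, if_pos ht, if_pos ⟨j, rfl⟩, Nat.add_sub_cancel, pow_succ, pow_mul, pow_mul, sq_abs,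
    mul_comm]

lemma ubar_eq_max {m : ℕ} (hm : Odd m) (t : ℝ) : ubar m t = max (1 - |t| ^ m) 0 := by
  by_cases ht : t ∈ Set.Icc (-1 : ℝ) 1
  · rw [ubar_eq hm t ht, max_eq_left]
    exact sub_nonneg.2 (pow_le_one₀ (abs_nonneg t) (abs_le.2 ht))
  · rw [ubar, if_neg ht, max_eq_right]
    rw [Set.mem_Icc, ← abs_le, not_le] at ht
    exact sub_nonpos.2 (one_le_pow₀ ht.le)

lemma continuous_ubar {m : ℕ} (hm : Odd m) : Continuous (ubar m) := by
  rw [funext (ubar_eq_max hm)]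
  fun_prop

lemma continuous_P (N : ℕ) (f : ℝ → ℝ) : Continuous (P N f) :=
  continuous_finsetSum _ fun i _ => (continuous_phi i).const_mul _

lemma continuous_r (N : ℕ) : Continuous (r N) :=
  (by fun_prop : Continuous fun t : ℝ => 1 + t).sub (continuous_P _ _)

lemma continuous_u {N k : ℕ} (h : Odd (N - k)) : Continuous (u N k) :=
  (continuous_ubar h).sub (continuous_P _ _)

/-- In the difference with 1 - |t|^m the powers |t|^m cancel, since X ^ m minus its orthogonal
component is an even polynomial. The blaschke coefficient of the ramp makes the value at ±1 zero,
because `muntz` takes that same value at 1. -/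
lemma u_eq {N K k : ℕ} (hN : 2 ≤ N) (hK : N + 1 = 2 * K) (hk : Odd (N - k)) {t : ℝ}
    (ht : t ∈ Set.Icc (-1 : ℝ) 1) :
    u N k t = blaschke evenNode K (N - k) * (rampEven K).eval t -
      (muntz evenNode K (N - k)).eval |t| := by
  set m := N - k with hm
  have hK1 : 1 ≤ K := by omega
  have e : ∀ t, (bumpProj K m).eval t = (1 - |t| ^ m) -
      (blaschke evenNode K m * (rampEven K).eval t - (muntz evenNode K m).eval |t|) := fun t => by
    have := eval_abs_of_mem_even (X_pow_sub_muntz_mem (c := evenNode) K m) t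
    simp only [bumpProj, eval_sub (p := (1 - (X ^ m - _))), eval_sub (p := 1), ← this]
    simp only [eval_sub, eval_pow, eval_one, eval_X, eval_mul, eval_C]
    ring
  have h1 : (bumpProj K m).eval 1 = 0 := by
    rw [e, rampEven_eval_one hK1, abs_one, muntz_eval_one evenNode_injective]
    simp
  have h2 : (bumpProj K m).eval (-1) = 0 := by
    rw [e, eval_neg_of_mem_even (rampEven_mem K), rampEven_eval_one hK1, abs_neg, abs_one,
      muntz_eval_one evenNode_injective]
    simp
  have : P N (ubar m) t = (bumpProj K m).eval t := by
    refine P_eq hN (bumpProj_natDegree hK m) h1 h2 ?_ t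
    intro i hi
    have hi := Finset.mem_Icc.1 hi
    have hd : ((phiPoly i).map (algebraMap ℚ ℝ)).natDegree ≤ N := by
      rw [natDegree_map, phiPoly_natDegree hi.1]
      exact hi.2
    have h1 : ((phiPoly i).map (algebraMap ℚ ℝ)).eval 1 = 0 := by rw [← phi_eq_eval, phi_one]
    have h2 : ((phiPoly i).map (algebraMap ℚ ℝ)).eval (-1) = 0 := by
      rw [← phi_eq_eval, phi_neg_one]
    simp only [e]
    rw [ip_sub_left (by fun_prop) (by fun_prop) (continuous_phi i),
      ip_sub_left (f' := fun t => (muntz evenNode K m).eval |t|) (by fun_prop) (by fun_prop)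
        (continuous_phi i), ip_smul_left]
    simp only [funext (phi_eq_eval i)]
    rw [ip_rampEven_eq_zero hK hd h1 h2, ip_muntz_eq_zero hK hd h1 h2, mul_zero, sub_zero,
      sub_zero]
    exact ip_congr (fun t ht => ubar_eq hk t ht) fun t _ => rfl
  rw [u, this, e, ← hm, ubar_eq hk t ht]
  ring

/-! ### Inner products -/

lemma ip_rampEven_self {K : ℕ} (hK : 1 ≤ K) :
    ip (fun t => (rampEven K).eval t) (fun t => (rampEven K).eval t) =
      2 / ((K : ℝ) * (2 * K - 1)) := by
  have := ip_eval_abs (rampEven K) (rampEven K)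
  simp only [eval_abs_of_mem_even (rampEven_mem K)] at this
  rw [this, unitForm_rampEven (rampEven_mem K), rampEven_eval_one hK]
  ring

lemma ip_rampOdd_self {K : ℕ} (hK : 1 ≤ K) :
    ip (fun t => (rampOdd K).eval t) (fun t => (rampOdd K).eval t) =
      2 / ((K : ℝ) * (2 * K + 1)) := by
  rw [ip_eval_of_odd (eval_neg_of_mem_odd (rampOdd_mem K)) (eval_neg_of_mem_odd (rampOdd_mem K)),
    unitForm_rampOdd (rampOdd_mem K), rampOdd_eval_one hK]
  ring

lemma ip_r_l {N K : ℕ} (hN : 2 ≤ N) (hK : N + 1 = 2 * K) : ip (r N) (l N) =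
    2 / ((K : ℝ) * (2 * K - 1)) - 2 / ((K : ℝ) * (2 * K + 1)) := by
  have hl : ∀ t, l N t = (rampEven K).eval t - (rampOdd K).eval t := fun t => by
    rw [l, r_eq hN hK, eval_neg_of_mem_even (rampEven_mem K), eval_neg_of_mem_odd (rampOdd_mem K)]
    ring
  rw [funext (r_eq hN hK), funext hl, ip_add_left (by fun_prop) (by fun_prop) (by fun_prop),
    ip_sub_right (by fun_prop) (by fun_prop) (by fun_prop),
    ip_sub_right (by fun_prop) (by fun_prop) (by fun_prop),
    ip_rampEven_self (by omega), ip_rampOdd_self (by omega),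
    ip_comm (fun t => (rampOdd K).eval t),
    ip_eq_zero_of_even_of_odd (eval_neg_of_mem_even (rampEven_mem K))
      (eval_neg_of_mem_odd (rampOdd_mem K))]
  ring

lemma ip_rampEven_muntz (K m : ℕ) :
    ip (fun t => (rampEven K).eval t) (fun t => (muntz evenNode K m).eval |t|) = 0 := by
  have := ip_eval_abs (rampEven K) (muntz evenNode K m)
  simp only [eval_abs_of_mem_even (rampEven_mem K)] at this
  rw [this, unitForm_comm, unitForm_muntz_of_mem evenNode_injective m (rampEven_mem K), mul_zero]

/-- The odd part of r is orthogonal to the even function u, and the even part of r is orthogonal to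
the `muntz` term; only the square of the even ramp survives. -/
lemma ip_r_u {N K k : ℕ} (hN : 2 ≤ N) (hK : N + 1 = 2 * K) (hk : Odd (N - k)) : ip (r N) (u N k) =
    blaschke evenNode K (N - k) * (2 / ((K : ℝ) * (2 * K - 1))) := by
  rw [ip_congr (fun t _ => r_eq hN hK t) (fun t ht => u_eq hN hK hk ht),
    ip_sub_right (by fun_prop) (by fun_prop) (by fun_prop), ip_smul_right,
    ip_add_left (by fun_prop) (by fun_prop) (by fun_prop),
    ip_add_left (by fun_prop) (by fun_prop) (by fun_prop), ip_rampEven_muntz,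
    ip_rampEven_self (by omega), ip_comm (fun t => (rampOdd K).eval t),
    ip_comm (fun t => (rampOdd K).eval t),
    ip_eq_zero_of_even_of_odd (eval_neg_of_mem_even (rampEven_mem K))
      (eval_neg_of_mem_odd (rampOdd_mem K)),
    ip_eq_zero_of_even_of_odd (by simp) (eval_neg_of_mem_odd (rampOdd_mem K))]
  ring

lemma ip_u_u {N K k k' : ℕ} (hN : 2 ≤ N) (hK : N + 1 = 2 * K)
    (hk : Odd (N - k)) (hk' : Odd (N - k')) : ip (u N k) (u N k') =
    blaschke evenNode K (N - k) * blaschke evenNode K (N - k') *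
      (2 / ((K : ℝ) * (2 * K - 1)) + 2 / (((N - k : ℕ) : ℝ) + (N - k' : ℕ) + 1)) := by
  rw [ip_congr (fun t ht => u_eq hN hK hk ht) (fun t ht => u_eq hN hK hk' ht),
    ip_sub_right (by fun_prop) (by fun_prop) (by fun_prop), ip_smul_right,
    ip_sub_left (by fun_prop) (by fun_prop) (by fun_prop),
    ip_sub_left (by fun_prop) (by fun_prop) (by fun_prop), ip_smul_left, ip_smul_left,
    ip_rampEven_muntz, ip_rampEven_self (by omega), ip_comm _ fun t => (rampEven K).eval t,
    ip_rampEven_muntz, ip_eval_abs, unitForm_muntz_muntz evenNode_injective]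
  ring

end ClosedForms

section Alpha

/-! ### The value of `α` -/

lemma prod_odd (k : ℕ) :
    (∏ j ∈ Finset.range k, (2 * (j : ℝ) + 1)) * 2 ^ k * k.factorial = (2 * k).factorial := by
  induction k with
  | zero => simp
  | succ k ih =>
    rw [Finset.prod_range_succ, show 2 * (k + 1) = 2 * k + 1 + 1 by ring, Nat.factorial_succ,
      Nat.factorial_succ, Nat.factorial_succ]
    push_cast
    rw [← ih]
    ring

lemma prod_add_eq_factorial (m k : ℕ) :
    (∏ j ∈ Finset.range k, ((m : ℝ) + 1 + j)) * m.factorial = (m + k).factorial := by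
  induction k with
  | zero => simp
  | succ k ih =>
    rw [Finset.prod_range_succ, ← add_assoc, Nat.factorial_succ]
    push_cast
    rw [← ih]
    ring

/-- The numerators are 1, -1, -3, …, with 2n minus signs that cancel; the denominators are 2(j+1).
-/
lemma blaschke_even_one (n : ℕ) :
    blaschke evenNode (2 * n + 1) 1 * (2 ^ (2 * n + 1) * (2 * n + 1).factorial) =
      ∏ j ∈ Finset.range (2 * n), (2 * (j : ℝ) + 1) := by
  have h : (2 : ℝ) ^ (2 * n + 1) * (2 * n + 1).factorial =
      ∏ j ∈ Finset.range (2 * n + 1), (((1 : ℕ) : ℝ) + evenNode j + 1) := by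
    have := prod_add_eq_factorial 0 (2 * n + 1)
    simp only [Nat.factorial_zero, Nat.cast_one, mul_one, zero_add, Nat.cast_zero] at this
    rw [← this]
    conv_lhs => rw [← Finset.card_range (2 * n + 1), ← Finset.prod_const, Finset.card_range,
      ← Finset.prod_mul_distrib]
    refine Finset.prod_congr rfl fun j _ => ?_
    simp only [evenNode]
    push_cast
    ring
  rw [blaschke, Finset.prod_div_distrib, h, div_mul_cancel₀, Finset.prod_range_succ']
  · have h1 : ∀ j ∈ Finset.range (2 * n), (((1 : ℕ) : ℝ) - evenNode (j + 1)) =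
        (-1) * (2 * (j : ℝ) + 1) := fun j _ => by
      simp only [evenNode]
      push_cast
      ring
    rw [Finset.prod_congr rfl h1, Finset.prod_mul_distrib, Finset.prod_const, Finset.card_range,
      pow_mul]
    simp [evenNode]
  · exact Finset.prod_ne_zero_iff.2 fun j _ => by positivity

/-- The numerators 2n-1-2j are the first n odd numbers in reverse order, followed by the negatives
of the first n+1 odd numbers; the denominators are 2(n+j). -/
lemma blaschke_even_middle {n : ℕ} (hn : 1 ≤ n) :
    blaschke evenNode (2 * n + 1) (2 * n - 1) *
      (2 ^ (2 * n + 1) * ∏ j ∈ Finset.range (2 * n + 1), ((n : ℝ) + j)) =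
      (-1) ^ (n + 1) * (∏ j ∈ Finset.range n, (2 * (j : ℝ) + 1)) *
        ∏ j ∈ Finset.range (n + 1), (2 * (j : ℝ) + 1) := by
  have hc : ((2 * n - 1 : ℕ) : ℝ) = 2 * n - 1 := by
    rw [Nat.cast_sub (by omega)]
    push_cast
    ring
  have h : (2 : ℝ) ^ (2 * n + 1) * ∏ j ∈ Finset.range (2 * n + 1), ((n : ℝ) + j) =
      ∏ j ∈ Finset.range (2 * n + 1), (((2 * n - 1 : ℕ) : ℝ) + evenNode j + 1) := by
    conv_lhs => rw [← Finset.card_range (2 * n + 1), ← Finset.prod_const, Finset.card_range,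
      ← Finset.prod_mul_distrib]
    refine Finset.prod_congr rfl fun j _ => ?_
    rw [hc]
    simp only [evenNode]
    push_cast
    ring
  rw [blaschke, Finset.prod_div_distrib, h, div_mul_cancel₀,
    show 2 * n + 1 = n + (n + 1) by ring, Finset.prod_range_add, ← Finset.prod_range_reflect]
  · have h1 : ∀ j ∈ Finset.range n, (((2 * n - 1 : ℕ) : ℝ) - evenNode (n - 1 - j)) =
        2 * (j : ℝ) + 1 := fun j hj => by
      have := Finset.mem_range.1 hj
      rw [hc, evenNode, Nat.cast_mul, Nat.sub_sub, Nat.cast_sub (by omega)]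
      push_cast
      ring
    have h2 : ∀ j ∈ Finset.range (n + 1), (((2 * n - 1 : ℕ) : ℝ) - evenNode (n + j)) =
        (-1) * (2 * (j : ℝ) + 1) := fun j _ => by
      rw [hc, evenNode]
      push_cast
      ring
    rw [Finset.prod_congr rfl h1, Finset.prod_congr rfl h2, Finset.prod_mul_distrib,
      Finset.prod_const, Finset.card_range]
    ring
  · exact Finset.prod_ne_zero_iff.2 fun j _ => by positivity

/-- This relation is the only property of α that the orthogonality argument uses: it removes every
factorial from the computation. -/
lemma alpha_mul_blaschke {n : ℕ} (hn : 1 ≤ n) :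
    3 * ((alpha n : ℝ) * blaschke evenNode (2 * n + 1) (2 * n - 1)) =
      -((4 * (n : ℝ) - 1) * blaschke evenNode (2 * n + 1) 1) := by
  have h1 := blaschke_even_one n
  have h2 := blaschke_even_middle hn
  have o1 := prod_odd n
  have o2 := prod_odd (n + 1)
  have o4 := prod_odd (2 * n)
  have hD : (∏ j ∈ Finset.range (2 * n + 1), ((n : ℝ) + j)) * (n - 1).factorial =
      (3 * n).factorial := by
    obtain ⟨m, rfl⟩ := Nat.exists_eq_add_of_le' hn
    have := prod_add_eq_factorial m (2 * (m + 1) + 1)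
    rw [show m + (2 * (m + 1) + 1) = 3 * (m + 1) by ring] at this
    rw [← this]
    simp
  have hf : (n.factorial : ℝ) = n * (n - 1).factorial := by
    exact_mod_cast (Nat.mul_factorial_pred (by omega)).symm
  have hf2 : ((2 * n).factorial : ℝ) = 2 * n * (2 * n - 1).factorial := by
    exact_mod_cast (Nat.mul_factorial_pred (by omega)).symm
  rw [show 2 * (2 * n) = 4 * n by ring] at o4
  rw [show 2 * (n + 1) = 2 * n + 2 by ring] at o2
  have hO1 : (∏ j ∈ Finset.range n, (2 * (j : ℝ) + 1)) ≠ 0 :=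
    Finset.prod_ne_zero_iff.2 fun j _ => by positivity
  have hO2 : (∏ j ∈ Finset.range (n + 1), (2 * (j : ℝ) + 1)) ≠ 0 :=
    Finset.prod_ne_zero_iff.2 fun j _ => by positivity
  have hD0 : (∏ j ∈ Finset.range (2 * n + 1), ((n : ℝ) + j)) ≠ 0 :=
    Finset.prod_ne_zero_iff.2 fun j _ => by positivity
  have hn0 : (n : ℝ) ≠ 0 := by positivity
  simp only [alpha]
  push_cast
  set O1 := ∏ j ∈ Finset.range n, (2 * (j : ℝ) + 1)
  set O2 := ∏ j ∈ Finset.range (n + 1), (2 * (j : ℝ) + 1)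
  set O4 := ∏ j ∈ Finset.range (2 * n), (2 * (j : ℝ) + 1)
  set D := ∏ j ∈ Finset.range (2 * n + 1), ((n : ℝ) + j)
  have hf3 : ((2 * n - 1).factorial : ℝ) = O1 * 2 ^ n * (n - 1).factorial / 2 := by
    rw [hf2, hf] at o1
    field_simp
    refine mul_left_cancel₀ hn0 ?_
    linear_combination -o1
  have e1 : blaschke evenNode (2 * n + 1) 1 = O4 / (2 ^ (2 * n + 1) * (2 * n + 1).factorial) := by
    rw [eq_div_iff (by positivity), h1]
  have e2 : blaschke evenNode (2 * n + 1) (2 * n - 1) =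
      (-1) ^ (n + 1) * O1 * O2 / (2 ^ (2 * n + 1) * D) := by
    rw [eq_div_iff (mul_ne_zero (by positivity) hD0), h2]
  have f1 : ((2 * n).factorial : ℝ) ≠ 0 := by positivity
  have f2 : ((2 * n + 1).factorial : ℝ) ≠ 0 := by positivity
  have f3 : ((n + 1).factorial : ℝ) ≠ 0 := by positivity
  have f4 : ((n - 1).factorial : ℝ) ≠ 0 := by positivity
  have hs : ((-1 : ℝ) ^ n) ^ 2 = 1 := by rw [← pow_mul, mul_comm, pow_mul]; simp
  rw [e1, e2, hf3, ← o4, ← o2, ← hD]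
  rw [show (2 : ℝ) ^ (2 * n + 1) = (2 ^ n) ^ 2 * 2 by rw [← pow_mul]; ring,
    show (2 : ℝ) ^ (2 * n) = (2 ^ n) ^ 2 by rw [← pow_mul]; ring, pow_succ, pow_succ]
  field_simp
  -- The signs of α and of the blaschke value multiply to an odd power of -1, up to the square of
  -- (-1)^n.
  linear_combination (-((4 * (n : ℝ) - 1) * O4 * 2 ^ n * 2)) * hs

/-! ### The orthogonality condition -/

section Orthogonality

variable {n : ℕ}

lemma odd_index_middle (hn : 1 ≤ n) : Odd (4 * n + 1 - 2 * (n + 1)) := ⟨n - 1, by omega⟩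

lemma odd_index_last (n : ℕ) : Odd (4 * n + 1 - 2 * (2 * n)) := ⟨0, by omega⟩

lemma continuous_wn (hn : 1 ≤ n) : Continuous (wn n) :=
  ((continuous_u (odd_index_middle hn)).const_mul _).add (continuous_u (odd_index_last n))

lemma ip_wn_right (hn : 1 ≤ n) {f : ℝ → ℝ} (hf : Continuous f) :
    ip f (wn n) = alpha n * ip f (u (4 * n + 1) (2 * (n + 1))) +
      ip f (u (4 * n + 1) (2 * (2 * n))) := by
  have h1 := continuous_u (odd_index_middle hn)
  have h2 := continuous_u (odd_index_last n)
  rw [← ip_smul_right, ← ip_add_right (by fun_prop) h2 hf]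
  rfl

lemma ip_wn_wn (hn : 1 ≤ n) : ip (wn n) (wn n) =
    ip (u (4 * n + 1) (2 * (n + 1))) (u (4 * n + 1) (2 * (n + 1))) * (alpha n : ℝ) ^ 2 +
    2 * ip (u (4 * n + 1) (2 * (n + 1))) (u (4 * n + 1) (2 * (2 * n))) * alpha n +
    ip (u (4 * n + 1) (2 * (2 * n))) (u (4 * n + 1) (2 * (2 * n))) := by
  rw [ip_wn_right hn (continuous_wn hn), ip_comm, ip_comm (wn n),
    ip_wn_right hn (continuous_u (odd_index_middle hn)),
    ip_wn_right hn (continuous_u (odd_index_last n)),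
    ip_comm (u (4 * n + 1) (2 * (2 * n))) (u (4 * n + 1) (2 * (n + 1)))]
  ring

lemma ip_r_l_value (hn : 1 ≤ n) : ip (r (4 * n + 1)) (l (4 * n + 1)) =
    2 / ((2 * (n : ℝ) + 1) * (4 * n + 1)) - 2 / ((2 * (n : ℝ) + 1) * (4 * n + 3)) := by
  rw [ip_r_l (K := 2 * n + 1) (by omega) (by ring)]
  push_cast
  ring_nf

lemma ip_r_l_pos (hn : 1 ≤ n) : 0 < ip (r (4 * n + 1)) (l (4 * n + 1)) := by
  rw [ip_r_l_value hn, sub_pos]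
  gcongr
  norm_num

lemma ip_r_wn (hn : 1 ≤ n) : ip (r (4 * n + 1)) (wn n) =
    -((4 * (n : ℝ) - 4) / 3 * blaschke evenNode (2 * n + 1) 1) *
      (2 / ((2 * (n : ℝ) + 1) * (4 * n + 1))) := by
  have ha := alpha_mul_blaschke hn
  have e1 : 4 * n + 1 - 2 * (n + 1) = 2 * n - 1 := by omega
  have e2 : 4 * n + 1 - 2 * (2 * n) = 1 := by omega
  rw [ip_wn_right hn (continuous_r _),
    ip_r_u (K := 2 * n + 1) (by omega) (by ring) (odd_index_middle hn),
    ip_r_u (K := 2 * n + 1) (by omega) (by ring) (odd_index_last n), e1, e2]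
  rw [show ((2 * n + 1 : ℕ) : ℝ) * (2 * (2 * n + 1 : ℕ) - 1) =
    (2 * (n : ℝ) + 1) * (4 * n + 1) by push_cast; ring]
  linear_combination (2 / ((2 * (n : ℝ) + 1) * (4 * n + 1))) / 3 * ha

/-- Write E = 2/((2n+1)(4n+1)), O = 2/((2n+1)(4n+3)) and y for the blaschke value at 1. Then ⟨r,w⟩²
= (16/9)(n-1)²y²E² and ⟨w,w⟩ = (16/9)(n-1)²y²(E + 1/(2n+1)), and (E - O)(E + 1/(2n+1)) = E². -/
lemma ip_r_l_mul_ip_wn (hn : 1 ≤ n) :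
    ip (r (4 * n + 1)) (l (4 * n + 1)) * ip (wn n) (wn n) = ip (r (4 * n + 1)) (wn n) ^ 2 := by
  have ha := alpha_mul_blaschke hn
  have e1 : 4 * n + 1 - 2 * (n + 1) = 2 * n - 1 := by omega
  have e2 : 4 * n + 1 - 2 * (2 * n) = 1 := by omega
  have hc : ((2 * n - 1 : ℕ) : ℝ) = 2 * n - 1 := by
    rw [Nat.cast_sub (by omega)]
    push_cast
    ring
  rw [ip_wn_wn hn, ip_r_wn hn, ip_r_l_value hn,
    ip_u_u (K := 2 * n + 1) (by omega) (by ring) (odd_index_middle hn) (odd_index_middle hn),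
    ip_u_u (K := 2 * n + 1) (by omega) (by ring) (odd_index_middle hn) (odd_index_last n),
    ip_u_u (K := 2 * n + 1) (by omega) (by ring) (odd_index_last n) (odd_index_last n), e1, e2,
    show ((2 * n + 1 : ℕ) : ℝ) * (2 * (2 * n + 1 : ℕ) - 1) =
      (2 * (n : ℝ) + 1) * (4 * n + 1) by push_cast; ring, hc, Nat.cast_one]
  set x := blaschke evenNode (2 * n + 1) (2 * n - 1)
  set y := blaschke evenNode (2 * n + 1) 1
  set a := (alpha n : ℝ)
  have hx : a * x = -((4 * (n : ℝ) - 1) / 3 * y) := by linear_combination ha / 3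
  have hn1 : (1 : ℝ) ≤ n := by exact_mod_cast hn
  have d1 : (2 * (n : ℝ) - 1 + (2 * n - 1) + 1) = 4 * n - 1 := by ring
  have d2 : (2 * (n : ℝ) - 1 + 1 + 1) = 2 * n + 1 := by ring
  have d3 : (4 * (n : ℝ) - 1) ≠ 0 := by linarith
  rw [d1, d2]
  -- Regrouped so that α enters only through the product `a * x`, whose value is known.
  have e : ∀ A B C : ℝ, x * x * A * a ^ 2 + 2 * (x * y * B) * a + y * y * C =
      (a * x) ^ 2 * A + 2 * (a * x) * y * B + y * y * C := fun A B C => by ring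
  have e' : ∀ A : ℝ, (-((4 * (n : ℝ) - 1) / 3 * y)) ^ 2 * (A + 2 / (4 * n - 1)) =
      y ^ 2 / 9 * ((4 * (n : ℝ) - 1) ^ 2 * A + 2 * (4 * n - 1)) := fun A => by
    generalize (4 * (n : ℝ) - 1) = z at d3
    field_simp
    ring
  rw [e, hx, e']
  field_simp
  ring

lemma blaschke_even_one_ne_zero (k : ℕ) : blaschke evenNode k 1 ≠ 0 :=
  blaschke_ne_zero fun j _ => by simp only [evenNode]; omega

/-- Read off from `ip_r_l_mul_ip_wn`, since ⟨r,l⟩ > 0 and ⟨r,w⟩ is a nonzero multiple of n - 1. For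
n = 1 the two functions u coincide, α = -1 and w = 0. -/
lemma ip_wn_wn_pos (hn : 1 < n) : 0 < ip (wn n) (wn n) := by
  have h := ip_r_l_mul_ip_wn hn.le
  have h0 : ip (r (4 * n + 1)) (wn n) ≠ 0 := by
    have hn1 : (1 : ℝ) < n := by exact_mod_cast hn
    rw [ip_r_wn hn.le]
    refine mul_ne_zero (neg_ne_zero.2 (mul_ne_zero ?_ (blaschke_even_one_ne_zero _)))
      (by positivity)
    have : (4 * (n : ℝ) - 4) ≠ 0 := by linarith
    positivity
  have h2 : 0 < ip (r (4 * n + 1)) (wn n) ^ 2 := by positivity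
  rw [← h] at h2
  exact (mul_pos_iff_of_pos_left (ip_r_l_pos hn.le)).1 h2

/-! ### Parity of `wn` and orthogonality of `qr`, `ql`, `wn` and the `phi i`. -/

lemma u_neg {N K k : ℕ} (hN : 2 ≤ N) (hK : N + 1 = 2 * K) (hk : Odd (N - k)) {t : ℝ}
    (ht : t ∈ Set.Icc (-1 : ℝ) 1) : u N k (-t) = u N k t := by
  have ht' : -t ∈ Set.Icc (-1 : ℝ) 1 := ⟨by linarith [ht.2], by linarith [ht.1]⟩
  rw [u_eq hN hK hk ht, u_eq hN hK hk ht', abs_neg, eval_neg_of_mem_even (rampEven_mem K)]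

lemma wn_neg (hn : 1 ≤ n) {t : ℝ} (ht : t ∈ Set.Icc (-1 : ℝ) 1) : wn n (-t) = wn n t := by
  simp only [wn, w]
  rw [u_neg (K := 2 * n + 1) (by omega) (by ring) (odd_index_middle hn) ht,
    u_neg (K := 2 * n + 1) (by omega) (by ring) (odd_index_last n) ht]

lemma ip_wn_comp_neg (hn : 1 ≤ n) (f : ℝ → ℝ) : ip (wn n) (fun t => f (-t)) = ip f (wn n) := by
  rw [ip_congr (f' := fun t => wn n (-t)) (fun t ht => (wn_neg hn ht).symm) fun _ _ => rfl,
    ip_comp_neg, ip_comm]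

lemma ip_wn_l (hn : 1 ≤ n) : ip (wn n) (l (4 * n + 1)) = ip (r (4 * n + 1)) (wn n) :=
  ip_wn_comp_neg hn _

lemma orthogonalityQuadratic_alpha (hn : 1 ≤ n) :
    orthogonalityQuadratic (4 * n + 1) (n + 1) (2 * n) (alpha n : ℝ) = 0 := by
  have h := ip_r_l_mul_ip_wn hn
  rw [ip_wn_wn hn, ip_wn_right hn (continuous_r _)] at h
  simp only [orthogonalityQuadratic, Matrix.det_fin_two_of, abs_of_pos (ip_r_l_pos hn)]
  linear_combination h

lemma continuous_qr (hn : 1 ≤ n) : Continuous (qr n) :=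
  (continuous_r _).sub ((continuous_wn hn).const_mul _)

lemma ip_qr_wn (hn : 1 < n) : ip (qr n) (wn n) = 0 := by
  have hw := continuous_wn hn.le
  unfold qr projLine
  rw [ip_sub_left (continuous_r _) (by fun_prop) hw, ip_smul_left,
    div_mul_cancel₀ _ (ip_wn_wn_pos hn).ne', sub_self]

/-- As q_r ⊥ w and w is even, the pairing equals ⟨r,l⟩ - ⟨r,w⟩²/⟨w,w⟩. -/
lemma ip_qr_ql (hn : 1 < n) : ip (qr n) (ql n) = 0 := by
  have hw := continuous_wn hn.le
  have hr := continuous_r (4 * n + 1)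
  have hl : Continuous (l (4 * n + 1)) := hr.comp continuous_neg
  have hq := continuous_qr hn.le
  have e : ∀ t, ql n t = l (4 * n + 1) t - ip (r (4 * n + 1)) (wn n) / ip (wn n) (wn n) *
    wn n (-t) := fun t => rfl
  have h1 : ip (qr n) (fun t => wn n (-t)) = 0 := by
    rw [ip_congr (g' := wn n) (fun _ _ => rfl) fun t ht => wn_neg hn.le ht, ip_qr_wn hn]
  rw [funext e, ip_sub_right hl (by fun_prop) hq, ip_smul_right, h1, mul_zero, sub_zero]
  unfold qr projLine
  rw [ip_sub_left hr (by fun_prop) hl, ip_smul_left, ip_wn_l hn.le]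
  have h := ip_r_l_mul_ip_wn hn.le
  have h0 := (ip_wn_wn_pos hn).ne'
  field_simp
  linear_combination h

lemma ip_wn_phi (hn : 1 ≤ n) {i : ℕ} (hi : i ∈ Finset.Icc 2 (4 * n + 1)) :
    ip (wn n) (phi i) = 0 := by
  rw [ip_comm, ip_wn_right hn (continuous_phi i), ip_comm, ip_comm (phi i)]
  have h1 : ip (u (4 * n + 1) (2 * (n + 1))) (phi i) = 0 :=
    ip_sub_P_phi hi (continuous_ubar (odd_index_middle hn))
  have h2 : ip (u (4 * n + 1) (2 * (2 * n))) (phi i) = 0 :=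
    ip_sub_P_phi hi (continuous_ubar (odd_index_last n))
  rw [h1, h2]
  ring

lemma ip_qr_phi (hn : 1 ≤ n) {i : ℕ} (hi : i ∈ Finset.Icc 2 (4 * n + 1)) :
    ip (qr n) (phi i) = 0 := by
  have hw := continuous_wn hn
  have h1 : ip (r (4 * n + 1)) (phi i) = 0 :=
    ip_sub_P_phi hi (by fun_prop : Continuous fun t : ℝ => 1 + t)
  unfold qr projLine
  rw [ip_sub_left (continuous_r _) (by fun_prop) (continuous_phi i), ip_smul_left,
    ip_wn_phi hn hi, h1]
  ring

end Orthogonality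

end Alpha

section Pieces

/-! ### Continuity of the scaling functions -/

lemma P_one (N : ℕ) (f : ℝ → ℝ) : P N f 1 = 0 :=
  Finset.sum_eq_zero fun i _ => by rw [projLine, phi_one, mul_zero]

lemma P_neg_one (N : ℕ) (f : ℝ → ℝ) : P N f (-1) = 0 :=
  Finset.sum_eq_zero fun i _ => by rw [projLine, phi_neg_one, mul_zero]

lemma r_one (N : ℕ) : r N 1 = 2 := by
  rw [r, P_one]
  norm_num

lemma r_neg_one (N : ℕ) : r N (-1) = 0 := by
  rw [r, P_neg_one]
  norm_num

lemma u_one {N k : ℕ} (hk : Odd (N - k)) : u N k 1 = 0 := by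
  rw [u, P_one, ubar_eq hk 1 (by norm_num)]
  simp

lemma u_neg_one {N k : ℕ} (hk : Odd (N - k)) : u N k (-1) = 0 := by
  rw [u, P_neg_one, ubar_eq hk (-1) (by norm_num)]
  simp

variable {n : ℕ}

lemma wn_one (hn : 1 ≤ n) : wn n 1 = 0 := by
  rw [wn, w, u_one (odd_index_middle hn), u_one (odd_index_last n)]
  simp

lemma wn_neg_one (hn : 1 ≤ n) : wn n (-1) = 0 := by
  rw [wn, w, u_neg_one (odd_index_middle hn), u_neg_one (odd_index_last n)]
  simp

lemma qr_one (hn : 1 ≤ n) : qr n 1 = 2 := by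
  rw [qr, projLine, wn_one hn, r_one]
  simp

lemma qr_neg_one (hn : 1 ≤ n) : qr n (-1) = 0 := by
  rw [qr, projLine, wn_neg_one hn, r_neg_one]
  simp

lemma continuous_ql (hn : 1 ≤ n) : Continuous (ql n) := (continuous_qr hn).comp continuous_neg

/-- Since g vanishes at ±1, extending by zero is the same as clamping the argument to [-1,1]. -/
lemma continuous_onUnit {g : ℝ → ℝ} (hg : Continuous g) (h1 : g 1 = 0) (h2 : g (-1) = 0) :
    Continuous (onUnit g) := by
  have : onUnit g = fun t => g (max (-1) (min 1 (2 * t - 1))) := by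
    funext t
    rw [onUnit]
    split_ifs with h
    · rw [min_eq_right (by linarith [h.2]), max_eq_right (by linarith [h.1])]
    · rcases lt_or_ge t 0 with ht | ht
      · rw [min_eq_right (by linarith), max_eq_left (by linarith), h2]
      · have : 1 ≤ t := by
          by_contra hlt
          exact h ⟨ht, not_le.1 hlt⟩
        rw [min_eq_left (by linarith), max_eq_right (by norm_num), h1]
  rw [this]
  fun_prop

lemma scaling0_eq_qr (hn : 1 ≤ n) (t : ℝ) : scaling0 n t = qr n (max (-1) (1 - 2 * |t|)) := by
  rw [scaling0]
  split_ifs with h h'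
  · rw [abs_of_neg h.2, max_eq_right (by linarith [h.1])]
    congr 1
    ring
  · rw [abs_of_nonneg h'.1, max_eq_right (by linarith [h'.2]), ql]
    congr 1
    ring
  · rw [max_eq_left, qr_neg_one hn]
    rcases lt_or_ge t 0 with ht | ht
    · have : t < -1 := by
        by_contra hlt
        exact h ⟨not_lt.1 hlt, ht⟩
      rw [abs_of_neg ht]
      linarith
    · have : 1 ≤ t := by
        by_contra hlt
        exact h' ⟨ht, not_le.1 hlt⟩
      rw [abs_of_nonneg ht]
      linarith

lemma continuous_scaling0 (hn : 1 ≤ n) : Continuous (scaling0 n) := by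
  have := continuous_qr hn
  rw [funext (scaling0_eq_qr hn)]
  fun_prop

lemma Phi_cases {p : (ℝ → ℝ) → Prop} (h0 : p (scaling0 n)) (h1 : p (onUnit (wn n)))
    (h2 : ∀ i ∈ Finset.Icc 2 (4 * n + 1), p (onUnit (phi i))) (j : Fin (4 * n + 2)) :
    p (Phi n j) := by
  rw [Phi]
  split_ifs with hj0 hj1
  · exact h0
  · exact h1
  · exact h2 j (Finset.mem_Icc.2 ⟨by omega, by omega⟩)

lemma continuous_Phi (hn : 1 ≤ n) (j : Fin (4 * n + 2)) : Continuous (Phi n j) :=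
  Phi_cases (continuous_scaling0 hn)
    (continuous_onUnit (continuous_wn hn) (wn_one hn) (wn_neg_one hn))
    (fun i _ => continuous_onUnit (continuous_phi i) (phi_one i) (phi_neg_one i)) j

/-- The hat-like function is glued from its two halves. -/
lemma scaling0_eq_add (n : ℕ) (t : ℝ) :
    scaling0 n t = onUnit (ql n) t + onUnit (qr n) (t + 1) := by
  rw [scaling0, onUnit, onUnit]
  by_cases h1 : -1 ≤ t ∧ t < 0
  · rw [if_pos h1, if_neg fun h => by linarith [h1.2, h.1],
      if_pos ⟨by linarith [h1.1], by linarith [h1.2]⟩, zero_add]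
    congr 1
    ring
  · have h2 : ¬(0 ≤ t + 1 ∧ t + 1 < 1) := fun h => h1 ⟨by linarith [h.1], by linarith [h.2]⟩
    rw [if_neg h1, if_neg h2, add_zero]

/-! ### Rational pieces -/

/-- On `[-1,0]` and on `[0,1]` the function `f` is a polynomial of degree at most `d` with rational
coefficients. -/
def RationalHalves (d : ℕ) (f : ℝ → ℝ) : Prop :=
  ∃ p q : ℚ[X], p.natDegree ≤ d ∧ q.natDegree ≤ d ∧
    (∀ t ∈ Set.Icc (-1 : ℝ) 0, f t = aeval t p) ∧ ∀ t ∈ Set.Icc (0 : ℝ) 1, f t = aeval t q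

/-- The rational numbers, as a subfield of the reals. -/
def ratField : Subfield ℝ := (algebraMap ℚ ℝ).fieldRange

lemma ratCast_mem (a : ℚ) : (a : ℝ) ∈ ratField := ⟨a, by simp⟩

lemma integral_aeval_mem (p : ℚ[X]) {a b : ℝ} (ha : a ∈ ratField) (hb : b ∈ ratField) :
    ∫ t in a..b, aeval t p ∈ ratField := by
  simp only [aeval_eq_sum_range]
  rw [intervalIntegral.integral_finsetSum fun i _ => by
    exact (by fun_prop : Continuous fun t : ℝ => p.coeff i • t ^ i).intervalIntegrable _ _]
  refine sum_mem fun i _ => ?_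
  simp only [Algebra.smul_def, intervalIntegral.integral_const_mul, integral_pow, eq_ratCast]
  refine mul_mem (ratCast_mem _) (div_mem (sub_mem (pow_mem hb _) (pow_mem ha _)) ?_)
  exact_mod_cast ratCast_mem ((i : ℚ) + 1)

namespace RationalHalves

variable {d : ℕ} {f g : ℝ → ℝ}

lemma of_polynomial {p : ℚ[X]} (hp : p.natDegree ≤ d) (h : ∀ t, f t = aeval t p) :
    RationalHalves d f :=
  ⟨p, p, hp, hp, fun t _ => h t, fun t _ => h t⟩

lemma add (hf : RationalHalves d f) (hg : RationalHalves d g) :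
    RationalHalves d fun t => f t + g t := by
  obtain ⟨p, q, hp, hq, h1, h2⟩ := hf
  obtain ⟨p', q', hp', hq', h1', h2'⟩ := hg
  exact ⟨p + p', q + q', natDegree_add_le_of_degree_le hp hp', natDegree_add_le_of_degree_le hq hq',
    fun t ht => by beta_reduce; rw [h1 t ht, h1' t ht, map_add],
    fun t ht => by beta_reduce; rw [h2 t ht, h2' t ht, map_add]⟩

lemma const_mul {a : ℝ} (ha : a ∈ ratField) (hf : RationalHalves d f) :
    RationalHalves d fun t => a * f t := by
  obtain ⟨a, rfl⟩ := ha
  obtain ⟨p, q, hp, hq, h1, h2⟩ := hf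
  exact ⟨C a * p, C a * q, (natDegree_C_mul_le _ _).trans hp, (natDegree_C_mul_le _ _).trans hq,
    fun t ht => by beta_reduce; rw [h1 t ht, map_mul, aeval_C],
    fun t ht => by beta_reduce; rw [h2 t ht, map_mul, aeval_C]⟩

lemma sub (hf : RationalHalves d f) (hg : RationalHalves d g) :
    RationalHalves d fun t => f t - g t := by
  have := hf.add (hg.const_mul (neg_mem (one_mem ratField)))
  simpa [sub_eq_add_neg] using this

lemma sum {ι : Type*} {s : Finset ι} {f : ι → ℝ → ℝ} (h : ∀ i ∈ s, RationalHalves d (f i)) :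
    RationalHalves d fun t => ∑ i ∈ s, f i t := by
  classical
  induction s using Finset.induction_on with
  | empty => exact of_polynomial (p := 0) (by simp) (by simp)
  | insert i s hi ih =>
    simp only [Finset.sum_insert hi]
    exact (h i (Finset.mem_insert_self i s)).add
      (ih fun j hj => h j (Finset.mem_insert_of_mem hj))

lemma comp_neg (hf : RationalHalves d f) : RationalHalves d fun t => f (-t) := by
  obtain ⟨p, q, hp, hq, h1, h2⟩ := hf
  refine ⟨q.comp (-X), p.comp (-X), ?_, ?_, fun t ht => ?_, fun t ht => ?_⟩
  · rwa [natDegree_comp, natDegree_neg, natDegree_X, mul_one]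
  · rwa [natDegree_comp, natDegree_neg, natDegree_X, mul_one]
  · beta_reduce
    rw [h2 (-t) ⟨by linarith [ht.2], by linarith [ht.1]⟩, aeval_comp, map_neg, aeval_X]
  · beta_reduce
    rw [h1 (-t) ⟨by linarith [ht.2], by linarith [ht.1]⟩, aeval_comp, map_neg, aeval_X]

/-- Integrals of rational polynomials over [-1,0] and [0,1] are rational; this makes all projection
coefficients rational. -/
lemma ip_mem {e : ℕ} (hf : RationalHalves d f) (hg : RationalHalves e g) (hfc : Continuous f)
    (hgc : Continuous g) : ip f g ∈ ratField := by
  obtain ⟨p, q, -, -, h1, h2⟩ := hf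
  obtain ⟨p', q', -, -, h1', h2'⟩ := hg
  have hi : Continuous fun t => f t * g t := hfc.mul hgc
  rw [ip, ← intervalIntegral.integral_add_adjacent_intervals (hi.intervalIntegrable (-1) 0)
    (hi.intervalIntegrable 0 1)]
  refine add_mem ?_ ?_
  · rw [intervalIntegral.integral_congr (g := fun t => aeval t (p * p'))]
    · exact integral_aeval_mem _ (neg_mem (one_mem _)) (zero_mem _)
    · intro t ht
      rw [Set.uIcc_of_le (by norm_num)] at ht
      simp only [h1 t ht, h1' t ht, map_mul]
  · rw [intervalIntegral.integral_congr (g := fun t => aeval t (q * q'))]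
    · exact integral_aeval_mem _ (zero_mem _) (one_mem _)
    · intro t ht
      rw [Set.uIcc_of_le (by norm_num)] at ht
      simp only [h2 t ht, h2' t ht, map_mul]

end RationalHalves

lemma rationalHalves_phi {i d : ℕ} (hi : 2 ≤ i) (hd : i ≤ d) : RationalHalves d (phi i) :=
  .of_polynomial ((phiPoly_natDegree hi).trans_le hd) (phi_eq_aeval i)

lemma rationalHalves_P {N d : ℕ} {f : ℝ → ℝ} (hf : RationalHalves d f) (hc : Continuous f) :
    RationalHalves N (P N f) := by
  refine RationalHalves.sum fun i hi => ?_
  have h := rationalHalves_phi (Finset.mem_Icc.1 hi).1 (Finset.mem_Icc.1 hi).2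
  exact h.const_mul (div_mem (hf.ip_mem h hc (continuous_phi i))
    (h.ip_mem h (continuous_phi i) (continuous_phi i)))

lemma rationalHalves_r {N : ℕ} (hN : 1 ≤ N) : RationalHalves N (r N) := by
  have h : RationalHalves N fun t => 1 + t := .of_polynomial (p := 1 + X)
    (natDegree_add_le_of_degree_le (by simp) (by rwa [natDegree_X])) (by simp)
  exact h.sub (rationalHalves_P h (by fun_prop))

lemma rationalHalves_ubar {m d : ℕ} (hm : Odd m) (hd : m ≤ d) : RationalHalves d (ubar m) := by
  refine ⟨1 + X ^ m, 1 - X ^ m, ?_, ?_, fun t ht => ?_, fun t ht => ?_⟩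
  · exact natDegree_add_le_of_degree_le (by simp) (by rwa [natDegree_X_pow])
  · exact natDegree_sub_le_of_le (m := d) (n := d) (by simp) (by rwa [natDegree_X_pow]) |>.trans
      (by simp)
  · rw [ubar_eq hm t ⟨ht.1, by linarith [ht.2]⟩, abs_of_nonpos ht.2, hm.neg_pow]
    simp
  · rw [ubar_eq hm t ⟨by linarith [ht.1], ht.2⟩, abs_of_nonneg ht.1]
    simp

lemma rationalHalves_u {N k : ℕ} (hk : Odd (N - k)) : RationalHalves N (u N k) := by
  have h := rationalHalves_ubar hk (Nat.sub_le N k)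
  exact h.sub (rationalHalves_P h (continuous_ubar hk))

lemma rationalHalves_wn (hn : 1 ≤ n) : RationalHalves (4 * n + 1) (wn n) :=
  ((rationalHalves_u (odd_index_middle hn)).const_mul (ratCast_mem _)).add
    (rationalHalves_u (odd_index_last n))

lemma rationalHalves_qr (hn : 1 ≤ n) : RationalHalves (4 * n + 1) (qr n) := by
  have hr := rationalHalves_r (N := 4 * n + 1) (by omega)
  have hw := rationalHalves_wn hn
  exact hr.sub (hw.const_mul (div_mem (hr.ip_mem hw (continuous_r _) (continuous_wn hn))
    (hw.ip_mem hw (continuous_wn hn) (continuous_wn hn))))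

lemma natDegree_comp_linear_le (p : ℚ[X]) (a b : ℚ) :
    (p.comp (C a * X + C b)).natDegree ≤ p.natDegree := by
  rw [natDegree_comp]
  exact (Nat.mul_le_mul_left _ (natDegree_linear_le)).trans (by simp)

lemma RationalHalves.hasRationalPieces_onUnit {d : ℕ} {g : ℝ → ℝ} (hg : RationalHalves d g) :
    HasRationalPieces d (onUnit g) := by
  obtain ⟨p, q, hp, hq, h1, h2⟩ := hg
  intro k
  by_cases h0 : k = 0
  · refine ⟨p.comp (C 2 * X + C (-1)), (natDegree_comp_linear_le ..).trans hp, fun t ht => ?_⟩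
    obtain ⟨ha, hb⟩ := ht
    rw [h0] at ha hb
    norm_num at ha hb
    rw [onUnit, if_pos ⟨ha, by linarith⟩, h1 _ ⟨by linarith, by linarith⟩, aeval_comp]
    simp [sub_eq_add_neg]
  by_cases h1 : k = 1
  · refine ⟨q.comp (C 2 * X + C (-1)), (natDegree_comp_linear_le ..).trans hq, fun t ht => ?_⟩
    obtain ⟨ha, hb⟩ := ht
    rw [h1] at ha hb
    norm_num at ha hb
    rw [onUnit, if_pos ⟨by linarith, by linarith⟩, h2 _ ⟨by linarith, by linarith⟩, aeval_comp]
    simp [sub_eq_add_neg]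
  · refine ⟨0, by simp, fun t ht => ?_⟩
    rw [onUnit, if_neg, map_zero]
    rintro ⟨ha, hb⟩
    obtain ⟨hc, hd⟩ := ht
    have h3 : (k : ℝ) < 2 := by linarith
    have h4 : (-1 : ℝ) < k := by linarith
    have h3' : k < 2 := by exact_mod_cast h3
    have h4' : -1 < k := by exact_mod_cast h4
    omega

lemma HasRationalPieces.add {d : ℕ} {f g : ℝ → ℝ} (hf : HasRationalPieces d f)
    (hg : HasRationalPieces d g) : HasRationalPieces d fun t => f t + g t := fun k => by
  obtain ⟨p, hp, h⟩ := hf k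
  obtain ⟨q, hq, h'⟩ := hg k
  exact ⟨p + q, natDegree_add_le_of_degree_le hp hq, fun t ht => by
    beta_reduce
    rw [h t ht, h' t ht, map_add]⟩

lemma HasRationalPieces.comp_add_one {d : ℕ} {f : ℝ → ℝ} (hf : HasRationalPieces d f) :
    HasRationalPieces d fun t => f (t + 1) := fun k => by
  -- A translation by 1 moves two half-intervals.
  obtain ⟨p, hp, h⟩ := hf (k + 2)
  refine ⟨p.comp (C 1 * X + C 1), (natDegree_comp_linear_le ..).trans hp, fun t ht => ?_⟩
  beta_reduce
  rw [h (t + 1) ⟨by push_cast; linarith [ht.1], by push_cast; linarith [ht.2]⟩, aeval_comp]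
  simp

lemma hasRationalPieces_Phi (hn : 1 ≤ n) (j : Fin (4 * n + 2)) :
    HasRationalPieces (4 * n + 1) (Phi n j) := by
  have hq := rationalHalves_qr hn
  refine Phi_cases ?_ (rationalHalves_wn hn).hasRationalPieces_onUnit (fun i hi =>
    (rationalHalves_phi (Finset.mem_Icc.1 hi).1
      (Finset.mem_Icc.1 hi).2).hasRationalPieces_onUnit) j
  rw [funext (scaling0_eq_add n)]
  exact (hq.comp_neg.hasRationalPieces_onUnit (g := ql n)).add
    hq.hasRationalPieces_onUnit.comp_add_one

end Pieces

section Translates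

/-! ### Orthogonality of the translates -/

section OnUnit

lemma onUnit_sub_mul_self (g h : ℝ → ℝ) (k t : ℝ) :
    onUnit g (t - k) * onUnit h (t - k) =
      (Set.Ico k (k + 1)).indicator
        (fun t => g (2 * t - (2 * k + 1)) * h (2 * t - (2 * k + 1))) t := by
  by_cases ht : t ∈ Set.Ico k (k + 1)
  · have h' : 0 ≤ t - k ∧ t - k < 1 := ⟨by linarith [ht.1], by linarith [ht.2]⟩
    rw [Set.indicator_of_mem ht, onUnit, onUnit, if_pos h', if_pos h',
      show 2 * (t - k) - 1 = 2 * t - (2 * k + 1) by ring]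
  · have h' : ¬(0 ≤ t - k ∧ t - k < 1) := fun h => ht ⟨by linarith [h.1], by linarith [h.2]⟩
    rw [Set.indicator_of_notMem ht, onUnit, if_neg h', zero_mul]

lemma onUnit_sub_mul_of_ne (g h : ℝ → ℝ) {k l : ℤ} (hkl : k ≠ l) (t : ℝ) :
    onUnit g (t - k) * onUnit h (t - l) = 0 := by
  rw [onUnit, onUnit]
  split_ifs with h1 h2
  · exfalso
    have e1 : (k : ℝ) < l + 1 := by linarith [h1.1, h2.2]
    have e2 : (l : ℝ) < k + 1 := by linarith [h1.2, h2.1]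
    have e1' : k < l + 1 := by exact_mod_cast e1
    have e2' : l < k + 1 := by exact_mod_cast e2
    omega
  all_goals simp

lemma integrable_onUnit_mul {g h : ℝ → ℝ} (hg : Continuous g) (hh : Continuous h) (k l : ℤ) :
    Integrable fun t : ℝ => onUnit g (t - k) * onUnit h (t - l) := by
  by_cases hkl : k = l
  · subst hkl
    simp only [onUnit_sub_mul_self]
    rw [integrable_indicator_iff measurableSet_Ico]
    exact (Continuous.integrableOn_Icc (by fun_prop)).mono_set Set.Ico_subset_Icc_self
  · simp only [onUnit_sub_mul_of_ne g h hkl]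
    exact integrable_zero _ _ _

lemma integral_onUnit_mul (g h : ℝ → ℝ) (k l : ℤ) :
    ∫ t : ℝ, onUnit g (t - k) * onUnit h (t - l) = if k = l then ip g h / 2 else 0 := by
  split_ifs with hkl
  · subst hkl
    simp only [onUnit_sub_mul_self]
    rw [integral_indicator measurableSet_Ico, integral_Ico_eq_integral_Ioc,
      ← intervalIntegral.integral_of_le (by linarith),
      intervalIntegral.integral_comp_mul_sub (fun t => g t * h t) (by norm_num : (2 : ℝ) ≠ 0), ip]
    rw [show 2 * (k : ℝ) - (2 * k + 1) = -1 by ring,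
      show 2 * ((k : ℝ) + 1) - (2 * k + 1) = 1 by ring, smul_eq_mul]
    ring
  · simp only [onUnit_sub_mul_of_ne g h hkl, integral_zero]

end OnUnit

/-- The restriction of the `j`-th generator to `[0,1)`, transported to `[-1,1)`. -/
def rightHalf (n : ℕ) (j : Fin (4 * n + 2)) : ℝ → ℝ :=
  if (j : ℕ) = 0 then ql n else if (j : ℕ) = 1 then wn n else phi j

/-- The restriction of the `j`-th generator to `[-1,0)`, transported to `[-1,1)`. -/
def leftHalf (n : ℕ) (j : Fin (4 * n + 2)) : ℝ → ℝ :=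
  if (j : ℕ) = 0 then qr n else 0

variable {n : ℕ}

lemma Phi_eq_halves (j : Fin (4 * n + 2)) (t : ℝ) :
    Phi n j t = onUnit (rightHalf n j) t + onUnit (leftHalf n j) (t + 1) := by
  rw [Phi, rightHalf, leftHalf]
  split_ifs
  · exact scaling0_eq_add n t
  all_goals simp [onUnit]

lemma Phi_sub_eq_halves (j : Fin (4 * n + 2)) (k : ℤ) (t : ℝ) :
    Phi n j (t - k) = onUnit (rightHalf n j) (t - k) + onUnit (leftHalf n j) (t - (k - 1 : ℤ)) := by
  rw [Phi_eq_halves, show t - (k : ℝ) + 1 = t - (k - 1 : ℤ) by push_cast; ring]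

lemma continuous_rightHalf (hn : 1 ≤ n) (j : Fin (4 * n + 2)) : Continuous (rightHalf n j) := by
  rw [rightHalf]
  split_ifs
  · exact continuous_ql hn
  · exact continuous_wn hn
  · exact continuous_phi _

lemma continuous_leftHalf (hn : 1 ≤ n) (j : Fin (4 * n + 2)) : Continuous (leftHalf n j) := by
  rw [leftHalf]
  split_ifs
  · exact continuous_qr hn
  · exact continuous_zero

lemma ip_zero_left (f : ℝ → ℝ) : ip 0 f = 0 := by simp [ip]

lemma ip_zero_right (f : ℝ → ℝ) : ip f 0 = 0 := by simp [ip]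

lemma ip_qr_polynomial (hn : 1 ≤ n) {p : ℝ[X]} (hp : p.natDegree ≤ 4 * n + 1)
    (h1 : p.eval 1 = 0) (h2 : p.eval (-1) = 0) : ip (qr n) (fun t => p.eval t) = 0 := by
  obtain ⟨a, ha⟩ := exists_eq_sum_phi (by omega) hp h1 h2
  rw [funext ha, ip_comm, ip_sum_left _ (fun i => (continuous_phi i).const_mul (a i))
    (continuous_qr hn)]
  refine Finset.sum_eq_zero fun i hi => ?_
  rw [ip_smul_left, ip_comm, ip_qr_phi hn hi, mul_zero]

/-- The reflected φ_i is again a polynomial of degree at most N vanishing at ±1, so no parity of the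
Jacobi polynomials is needed. -/
lemma ip_ql_phi (hn : 1 ≤ n) {i : ℕ} (hi : i ∈ Finset.Icc 2 (4 * n + 1)) :
    ip (ql n) (phi i) = 0 := by
  have h : ip (qr n) (fun t => phi i (-t)) = 0 := by
    have e : ∀ t, phi i (-t) = (((phiPoly i).map (algebraMap ℚ ℝ)).comp (-X)).eval t := fun t => by
      rw [phi_eq_eval, eval_comp, eval_neg, eval_X]
    rw [funext e]
    refine ip_qr_polynomial hn ?_ ?_ ?_
    · rw [natDegree_comp, natDegree_neg, natDegree_X, mul_one, natDegree_map,
        phiPoly_natDegree (Finset.mem_Icc.1 hi).1]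
      exact (Finset.mem_Icc.1 hi).2
    · rw [← e, phi_neg_one]
    · rw [← e, neg_neg, phi_one]
  rw [← ip_comp_neg] at h
  simp only [neg_neg] at h
  exact h

lemma ip_ql_wn (hn : 1 < n) : ip (ql n) (wn n) = 0 := by
  rw [ip_comm, show ql n = fun t => qr n (-t) from rfl, ip_wn_comp_neg hn.le, ip_qr_wn hn]

lemma ip_right_left (hn : 1 < n) (i j : Fin (4 * n + 2)) :
    ip (rightHalf n i) (leftHalf n j) = 0 := by
  rw [rightHalf, leftHalf]
  split_ifs with h1 h2 h3 h4 h5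
  · rw [ip_comm, ip_qr_ql hn]
  · exact ip_zero_right _
  · rw [ip_comm, ip_qr_wn hn]
  · exact ip_zero_right _
  · rw [ip_comm, ip_qr_phi hn.le (Finset.mem_Icc.2 ⟨by omega, by omega⟩)]
  · exact ip_zero_right _

lemma ip_left_left {i j : Fin (4 * n + 2)} (hij : i ≠ j) :
    ip (leftHalf n i) (leftHalf n j) = 0 := by
  rw [leftHalf, leftHalf]
  split_ifs with h1 h2
  · exact absurd (Fin.ext (h1.trans h2.symm)) hij
  all_goals first | exact ip_zero_right _ | exact ip_zero_left _

lemma ip_right_right (hn : 1 < n) {i j : Fin (4 * n + 2)} (hij : i ≠ j) :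
    ip (rightHalf n i) (rightHalf n j) = 0 := by
  wlog hlt : i < j generalizing i j
  · rw [ip_comm]
    exact this hij.symm (lt_of_le_of_ne (not_lt.1 hlt) hij.symm)
  have hlt : (i : ℕ) < j := hlt
  have hj0 : (j : ℕ) ≠ 0 := by omega
  simp only [rightHalf, if_neg hj0]
  by_cases hj1 : (j : ℕ) = 1
  · have hi0 : (i : ℕ) = 0 := by omega
    rw [if_pos hj1, if_pos hi0, ip_ql_wn hn]
  · rw [if_neg hj1]
    have hj : (j : ℕ) ∈ Finset.Icc 2 (4 * n + 1) := Finset.mem_Icc.2 ⟨by omega, by omega⟩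
    split_ifs with hi0 hi1
    · exact ip_ql_phi hn.le hj
    · exact ip_wn_phi hn.le hj
    · exact ip_phi_phi (by omega) (by omega) (by omega)

/-- Each translate is split into its pieces on unit intervals. A right piece meets a left piece only
for neighbouring translates, and those pairings vanish by `ip_right_left`. -/
lemma integral_Phi_mul (hn : 1 < n) (i j : Fin (4 * n + 2)) (k l : ℤ) :
    ∫ t : ℝ, Phi n i (t - k) * Phi n j (t - l) =
      if k = l then (ip (rightHalf n i) (rightHalf n j) + ip (leftHalf n i) (leftHalf n j)) / 2
      else 0 := by
  have hr := continuous_rightHalf (n := n) hn.le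
  have hl := continuous_leftHalf (n := n) hn.le
  simp only [Phi_sub_eq_halves, mul_add, add_mul]
  rw [integral_add, integral_add, integral_add]
  · simp only [integral_onUnit_mul, ip_right_left hn, ip_comm (leftHalf n i) (rightHalf n j),
      sub_left_inj]
    split_ifs <;> simp <;> ring
  · exact integrable_onUnit_mul (hr i) (hl j) _ _
  · exact integrable_onUnit_mul (hl i) (hl j) _ _
  · exact integrable_onUnit_mul (hr i) (hr j) _ _
  · exact integrable_onUnit_mul (hl i) (hr j) _ _
  · exact (integrable_onUnit_mul (hr i) (hr j) _ _).add (integrable_onUnit_mul (hl i) (hr j) _ _)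
  · exact (integrable_onUnit_mul (hr i) (hl j) _ _).add (integrable_onUnit_mul (hl i) (hl j) _ _)

/-- The squared norm of the `j`-th generator. -/
def normSqPhi (n : ℕ) (j : Fin (4 * n + 2)) : ℝ :=
  (ip (rightHalf n j) (rightHalf n j) + ip (leftHalf n j) (leftHalf n j)) / 2

lemma ip_self_nonneg (f : ℝ → ℝ) : 0 ≤ ip f f :=
  intervalIntegral.integral_nonneg (by norm_num) fun _ _ => mul_self_nonneg _

lemma normSqPhi_pos (hn : 1 < n) (j : Fin (4 * n + 2)) : 0 < normSqPhi n j := by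
  have h1 := ip_self_nonneg (leftHalf n j)
  rw [normSqPhi]
  suffices 0 < ip (rightHalf n j) (rightHalf n j) by linarith
  rw [rightHalf]
  split_ifs
  · have hq := continuous_ql hn.le
    have h : ql n (-1) = 2 := by rw [ql, neg_neg, qr_one hn.le]
    exact intervalIntegral.integral_pos (by norm_num) (by fun_prop)
      -- The integrand is 4 at -1, the point mapped to the peak of the first generator.
      (fun t _ => mul_self_nonneg _) ⟨-1, by norm_num, by rw [h]; norm_num⟩
  · exact ip_wn_wn_pos hn
  · exact ip_phi_self_pos _

lemma hasCompactSupport_Phi (j : Fin (4 * n + 2)) : HasCompactSupport (Phi n j) := by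
  refine HasCompactSupport.intro (isCompact_Icc (a := (-1 : ℝ)) (b := 1)) fun t ht => ?_
  rw [Phi_eq_halves, onUnit, onUnit, if_neg, if_neg, add_zero]
  · exact fun h => ht ⟨by linarith [h.1], by linarith [h.2]⟩
  · exact fun h => ht ⟨by linarith [h.1], by linarith [h.2]⟩

lemma memLp_Phi (hn : 1 ≤ n) (j : Fin (4 * n + 2)) : MemLp (Phi n j) 2 (volume : Measure ℝ) :=
  (continuous_Phi hn j).memLp_of_hasCompactSupport (hasCompactSupport_Phi j)

lemma shifts_ae {ι : Type*} (φ : ι → ℝ → ℝ) (h : ∀ i, MemLp (φ i) 2 (volume : Measure ℝ))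
    (a : ι × ℤ) : shifts φ h a =ᵐ[volume] fun t => φ a.1 (t - a.2) :=
  MemLp.coeFn_toLp _

lemma inner_shifts {ι : Type*} (φ : ι → ℝ → ℝ) (h : ∀ i, MemLp (φ i) 2 (volume : Measure ℝ))
    (a b : ι × ℤ) :
    inner ℝ (shifts φ h a) (shifts φ h b) = ∫ t : ℝ, φ a.1 (t - a.2) * φ b.1 (t - b.2) := by
  rw [L2.inner_def]
  refine integral_congr_ae ?_
  filter_upwards [shifts_ae φ h a, shifts_ae φ h b] with t ha hb
  rw [ha, hb]
  simp [mul_comm]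

lemma inner_shifts_Phi (hn : 1 < n) (h : ∀ i, MemLp (Phi n i) 2 (volume : Measure ℝ))
    {a b : Fin (4 * n + 2) × ℤ} (hab : a ≠ b) :
    inner ℝ (shifts (Phi n) h a) (shifts (Phi n) h b) = 0 := by
  rw [inner_shifts, integral_Phi_mul hn]
  split_ifs with hk
  · have hij : a.1 ≠ b.1 := fun hij => hab (Prod.ext hij hk)
    rw [ip_right_right hn hij, ip_left_left hij]
    norm_num
  · rfl

lemma norm_sq_shifts_Phi (hn : 1 < n) (h : ∀ i, MemLp (Phi n i) 2 (volume : Measure ℝ))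
    (a : Fin (4 * n + 2) × ℤ) : ‖shifts (Phi n) h a‖ ^ 2 = normSqPhi n a.1 := by
  rw [← real_inner_self_eq_norm_sq, inner_shifts, integral_Phi_mul hn, if_pos rfl, normSqPhi]

/-- An orthogonal family with finitely many norms, all positive, is a Riesz basis of its closed
span. -/
lemma isRieszBasis_of_orthogonal {ι κ H : Type*} [Finite ι] [Nonempty ι] [NormedAddCommGroup H]
    [InnerProductSpace ℝ H] {e : ι × κ → H} (ho : Pairwise fun k l => inner ℝ (e k) (e l) = 0)
    {ν : ι → ℝ} (hν : ∀ i, 0 < ν i) (he : ∀ k, ‖e k‖ ^ 2 = ν k.1) :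
    IsRieszBasis e (Submodule.span ℝ (Set.range e)).topologicalClosure := by
  obtain ⟨i₀, hi₀⟩ := Finite.exists_min ν
  obtain ⟨i₁, hi₁⟩ := Finite.exists_max ν
  refine ⟨rfl, ν i₀, ν i₁, hν _, hν _, fun c => ?_⟩
  have key : ‖∑ k ∈ c.support, c k • e k‖ ^ 2 = ∑ k ∈ c.support, c k ^ 2 * ν k.1 := by
    rw [← real_inner_self_eq_norm_sq, sum_inner]
    refine Finset.sum_congr rfl fun k hk => ?_
    rw [inner_sum, Finset.sum_eq_single_of_mem k hk]
    · rw [real_inner_smul_left, real_inner_smul_right, real_inner_self_eq_norm_sq, he]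
      ring
    · intro l _ hl
      rw [real_inner_smul_left, real_inner_smul_right, ho hl.symm]
      ring
  rw [key, Finset.mul_sum, Finset.mul_sum]
  constructor <;> refine Finset.sum_le_sum fun k _ => ?_
  · nlinarith [sq_nonneg (c k), hi₀ k.1]
  · nlinarith [sq_nonneg (c k), hi₁ k.1]

end Translates

section Nested

/-! ### Continuous piecewise polynomials are finite combinations of the translates -/

variable {n : ℕ}

/-- The algebraic span of the integer translates of the generators, as functions. -/
def translateSpan (n : ℕ) : Submodule ℝ (ℝ → ℝ) :=
  Submodule.span ℝ (Set.range fun a : Fin (4 * n + 2) × ℤ => fun t : ℝ => Phi n a.1 (t - a.2))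

/-- Only the summand with k = ⌊t⌋ is nonzero at t; the hypothesis covers the case ⌊t⌋ ∉ T. -/
lemma sum_onUnit {G : ℤ → ℝ → ℝ} {T : Finset ℤ}
    (hT : ∀ k ∉ T, ∀ s ∈ Set.Ico (-1 : ℝ) 1, G k s = 0) (t : ℝ) :
    ∑ k ∈ T, onUnit (G k) (t - k) = G ⌊t⌋ (2 * (t - ⌊t⌋) - 1) := by
  have h1 := Int.floor_le t
  have h2 := Int.lt_floor_add_one t
  rw [Finset.sum_eq_single ⌊t⌋]
  · rw [onUnit, if_pos ⟨by linarith, by linarith⟩]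
  · intro k _ hk
    rw [onUnit, if_neg]
    rintro ⟨h3, h4⟩
    exact hk (Int.floor_eq_iff.2 ⟨by linarith, by linarith⟩).symm
  · intro h
    rw [onUnit, if_pos ⟨by linarith, by linarith⟩]
    exact hT _ h _ ⟨by linarith, by linarith⟩

lemma Phi_sub_mem (j : Fin (4 * n + 2)) (k : ℤ) :
    (fun t : ℝ => Phi n j (t - k)) ∈ translateSpan n :=
  Submodule.subset_span ⟨(j, k), rfl⟩

lemma onUnit_mem {G : ℝ → ℝ} {a : ℕ → ℝ} {d : ℝ}
    (hG : ∀ s ∈ Set.Ico (-1 : ℝ) 1,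
      G s = ∑ i ∈ Finset.Icc 2 (4 * n + 1), a i * phi i s + d * wn n s) (k : ℤ) :
    (fun t : ℝ => onUnit G (t - k)) ∈ translateSpan n := by
  have e : (fun t : ℝ => onUnit G (t - k)) =
      (∑ i ∈ Finset.Icc 2 (4 * n + 1), a i • fun t : ℝ => onUnit (phi i) (t - k)) +
        d • fun t : ℝ => onUnit (wn n) (t - k) := by
    funext t
    simp only [Pi.add_apply, Finset.sum_apply, Pi.smul_apply, smul_eq_mul]
    by_cases h : 0 ≤ t - k ∧ t - k < 1
    · simp only [onUnit, if_pos h]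
      exact hG _ ⟨by linarith [h.1], by linarith [h.2]⟩
    · simp only [onUnit, if_neg h, mul_zero, Finset.sum_const_zero, add_zero]
  rw [e]
  refine add_mem (sum_mem fun i hi => Submodule.smul_mem _ _ ?_) (Submodule.smul_mem _ _ ?_)
  · have hi := Finset.mem_Icc.1 hi
    have := Phi_sub_mem (n := n) ⟨i, by omega⟩ k
    simpa only [Phi, if_neg (by omega : ¬i = 0), if_neg (by omega : ¬i = 1)] using this
  · have := Phi_sub_mem (n := n) ⟨1, by omega⟩ k
    simpa only [Phi, if_neg one_ne_zero, if_true] using this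

/-- The ramp as a polynomial. -/
def rampPoly (n : ℕ) : ℝ[X] := rampEven (2 * n + 1) + rampOdd (2 * n + 1)

lemma r_eq_rampPoly (hn : 1 ≤ n) (t : ℝ) : r (4 * n + 1) t = (rampPoly n).eval t := by
  rw [r_eq (K := 2 * n + 1) (by omega) (by ring), rampPoly, eval_add]

lemma rampPoly_natDegree (n : ℕ) : (rampPoly n).natDegree ≤ 4 * n + 1 := by
  refine natDegree_add_le_of_degree_le
    (natDegree_le_of_mem_monoSpan (fun j hj => ?_) (rampEven_mem _))
    (natDegree_le_of_mem_monoSpan (fun j hj => ?_) (rampOdd_mem _))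
  · simp only [evenNode]; omega
  · simp only [oddNode]; omega

/-- A polynomial minus the ramps with the same boundary values lies in the span of the generators
supported on one interval. -/
lemma exists_eq_sum_phi_add_wn (hn : 1 ≤ n) {p : ℝ[X]} (hp : p.natDegree ≤ 4 * n + 1) :
    ∃ (a : ℕ → ℝ) (d : ℝ), ∀ s ∈ Set.Ico (-1 : ℝ) 1,
      p.eval s - p.eval (-1) / 2 * ql n s - p.eval 1 / 2 * qr n s =
        ∑ i ∈ Finset.Icc 2 (4 * n + 1), a i * phi i s + d * wn n s := by
  have hR := rampPoly_natDegree n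
  have hR' : ((rampPoly n).comp (-X)).natDegree ≤ 4 * n + 1 := by
    rwa [natDegree_comp, natDegree_neg, natDegree_X, mul_one]
  have h1 : (rampPoly n).eval 1 = 2 := by rw [← r_eq_rampPoly hn, r_one]
  have h2 : (rampPoly n).eval (-1) = 0 := by rw [← r_eq_rampPoly hn, r_neg_one]
  set x := p.eval (-1) / 2 with hx
  set y := p.eval 1 / 2 with hy
  obtain ⟨a, ha⟩ := exists_eq_sum_phi (N := 4 * n + 1) (by omega)
    (g := p - C x * (rampPoly n).comp (-X) - C y * rampPoly n)
    ((natDegree_sub_le_of_le (natDegree_sub_le_of_le hp ((natDegree_C_mul_le _ _).trans hR'))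
      ((natDegree_C_mul_le _ _).trans hR)).trans (by simp))
    (by
      simp only [eval_sub, eval_mul, eval_C, eval_comp, eval_neg, eval_X, h1, h2, hy]
      ring)
    (by
      simp only [eval_sub, eval_mul, eval_C, eval_comp, eval_neg, eval_X, neg_neg, h1, h2, hx]
      ring)
  -- As w is even, q_l and q_r differ from their ramps by the same multiple of w; hence the factor x
  -- + y.
  refine ⟨a, ip (r (4 * n + 1)) (wn n) / ip (wn n) (wn n) * (x + y), fun s hs => ?_⟩
  rw [← ha s, ql, qr, qr, projLine, projLine, wn_neg hn ⟨hs.1, hs.2.le⟩, r_eq_rampPoly hn,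
    r_eq_rampPoly hn]
  simp only [eval_sub, eval_mul, eval_C, eval_comp, eval_neg, eval_X]
  ring

/-- Continuous compactly supported piecewise polynomials with integer knots are finite
combinations of translates of the generators. -/
lemma mem_translateSpan (hn : 1 ≤ n) {f : ℝ → ℝ} (hf : Continuous f) (hs : HasCompactSupport f)
    (hp : ∀ k : ℤ, ∃ p : ℝ[X], p.natDegree ≤ 4 * n + 1 ∧
      ∀ t ∈ Set.Ico (k : ℝ) (k + 1), f t = p.eval t) : f ∈ translateSpan n := by
  obtain ⟨R, hR⟩ : ∃ R : ℕ, ∀ t : ℝ, (R : ℝ) ≤ |t| → f t = 0 := by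
    obtain ⟨M, hM⟩ := hs.isCompact.isBounded.subset_closedBall 0
    obtain ⟨R, hR⟩ := exists_nat_gt M
    refine ⟨R, fun t ht => ?_⟩
    by_contra h
    have := hM (subset_tsupport f h)
    rw [Metric.mem_closedBall, dist_zero_right, Real.norm_eq_abs] at this
    linarith
  set T := Finset.Ico (-(R : ℤ)) R with hT
  have hTf : ∀ k ∉ T, ∀ t ∈ Set.Icc (k : ℝ) (k + 1), f t = 0 := fun k hk t ht => by
    refine hR t ?_
    rw [hT, Finset.mem_Ico, not_and_or, not_le, not_lt] at hk
    rcases hk with hk | hk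
    · have : (k : ℝ) + 1 ≤ -R := by exact_mod_cast hk
      exact le_trans (by linarith [ht.2]) (neg_le_abs t)
    · have : (R : ℝ) ≤ k := by exact_mod_cast hk
      exact le_trans (by linarith [ht.1]) (le_abs_self t)
  have hTk : ∀ k ∉ T, f k = 0 := fun k hk => hTf k hk k ⟨le_rfl, by linarith⟩
  -- The first generator has value 2 at its centre, so the weight f(k)/2 matches f at the integer k.
  -- What remains on [k,k+1], rescaled to [-1,1], is `G k`.
  set G : ℤ → ℝ → ℝ := fun k s =>
    f (k + (s + 1) / 2) - f k / 2 * ql n s - f (k + 1 : ℤ) / 2 * qr n s with hG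
  have hf0 : Phi n ⟨0, by omega⟩ = scaling0 n := by simp [Phi]
  have key : f = ∑ k ∈ T, (fun t : ℝ => onUnit (G k) (t - k)) +
      ∑ k ∈ T, (f k / 2) • fun t : ℝ => Phi n ⟨0, by omega⟩ (t - k) := by
    funext t
    simp only [Pi.add_apply, Finset.sum_apply, Pi.smul_apply, smul_eq_mul, hf0, scaling0_eq_add,
      mul_add, Finset.sum_add_distrib]
    rw [sum_onUnit]
    · have e1 : ∑ k ∈ T, f k / 2 * onUnit (ql n) (t - k) =
          f ⌊t⌋ / 2 * ql n (2 * (t - ⌊t⌋) - 1) := by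
        rw [← sum_onUnit (G := fun k s => f k / 2 * ql n s) (T := T)
          (fun k hk s _ => by simp [hTk k hk])]
        exact Finset.sum_congr rfl fun k _ => by simp [onUnit]
      have e2 : ∑ k ∈ T, f k / 2 * onUnit (qr n) (t - k + 1) =
          f (⌊t⌋ + 1 : ℤ) / 2 * qr n (2 * (t - ⌊t⌋) - 1) := by
        have := sum_onUnit (G := fun k s => f k / 2 * qr n s) (T := T)
          (fun k hk s _ => by simp [hTk k hk]) (t + 1)
        rw [Int.floor_add_one] at this
        rw [show 2 * (t - (⌊t⌋ : ℝ)) - 1 = 2 * (t + 1 - (⌊t⌋ + 1 : ℤ)) - 1 by push_cast; ring,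
          ← this]
        exact Finset.sum_congr rfl fun k _ => by
          rw [show t - (k : ℝ) + 1 = t + 1 - k by ring]
          simp [onUnit]
      rw [e1, e2, hG]
      beta_reduce
      rw [show (⌊t⌋ : ℝ) + (2 * (t - ⌊t⌋) - 1 + 1) / 2 = t by ring]
      ring
    · intro k hk s hs
      have h3 : f (k + 1 : ℤ) = 0 := hTf k hk _ ⟨by push_cast; linarith, by push_cast; linarith⟩
      have h4 : f (k + (s + 1) / 2) = 0 := hTf k hk _ ⟨by linarith [hs.1], by linarith [hs.2]⟩
      simp only [hG, h3, h4, hTk k hk]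
      ring
  rw [key]
  refine add_mem (sum_mem fun k _ => ?_) (sum_mem fun k _ =>
    Submodule.smul_mem _ _ (Phi_sub_mem _ k))
  obtain ⟨p, hpd, hpf⟩ := hp k
  -- Continuity of f carries the polynomial formula to the right endpoint, whose value enters `G k`.
  have hpc : ∀ t ∈ Set.Icc (k : ℝ) (k + 1), f t = p.eval t := by
    have hcl : IsClosed {t | f t = p.eval t} := isClosed_eq hf (by fun_prop)
    have := hcl.closure_subset_iff.2 (fun t ht => hpf t ht : Set.Ico (k : ℝ) (k + 1) ⊆ _)
    rw [closure_Ico (by linarith : (k : ℝ) ≠ k + 1)] at this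
    exact fun t ht => this ht
  set q : ℝ[X] := p.comp (C (1 / 2 : ℝ) * X + C ((k : ℝ) + 1 / 2)) with hq
  have hqe : ∀ s, q.eval s = p.eval (k + (s + 1) / 2) := fun s => by
    rw [hq, eval_comp]
    congr 1
    simp only [eval_add, eval_mul, eval_C, eval_X]
    ring
  have hqd : q.natDegree ≤ 4 * n + 1 := by
    rw [hq, natDegree_comp]
    exact ((Nat.mul_le_mul_left _ natDegree_linear_le).trans (by simp)).trans hpd
  obtain ⟨a, d, had⟩ := exists_eq_sum_phi_add_wn hn hqd
  refine onUnit_mem (a := a) (d := d) (fun s hs => ?_) k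
  rw [← had s hs, hqe, hqe, hqe, ← hpc _ ⟨by linarith [hs.1], by linarith [hs.2]⟩,
    ← hpc _ ⟨by linarith, by linarith⟩, ← hpc _ ⟨by linarith, by linarith⟩]
  simp only [hG]
  push_cast
  norm_num

lemma exists_span_shifts_of_mem (h : ∀ i, MemLp (Phi n i) 2 (volume : Measure ℝ)) {f : ℝ → ℝ}
    (hf : f ∈ translateSpan n) :
    ∃ F ∈ Submodule.span ℝ (Set.range (shifts (Phi n) h)), F =ᵐ[volume] f := by
  induction hf using Submodule.span_induction with
  | mem x hx =>
    obtain ⟨a, rfl⟩ := hx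
    exact ⟨_, Submodule.subset_span ⟨a, rfl⟩, shifts_ae _ h a⟩
  | zero => exact ⟨0, zero_mem _, Lp.coeFn_zero _ _ _⟩
  | add x y _ _ hx hy =>
    obtain ⟨F, hF, hFx⟩ := hx
    obtain ⟨F', hF', hFy⟩ := hy
    exact ⟨F + F', add_mem hF hF', (Lp.coeFn_add F F').trans (hFx.add hFy)⟩
  | smul c x _ hx =>
    obtain ⟨F, hF, hFx⟩ := hx
    exact ⟨c • F, Submodule.smul_mem _ c hF, (Lp.coeFn_smul c F).trans (hFx.const_smul c)⟩

/-! ### Dilations and nestedness -/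

/-- Halving pushes Lebesgue measure to twice itself, so `dilate` factors through L² of the doubled
measure. -/
lemma measurePreserving_half : MeasurePreserving (fun t : ℝ => 2⁻¹ * t) volume
    ((2 : ENNReal) • (volume : Measure ℝ)) :=
  ⟨by fun_prop, by
    rw [Real.map_volume_mul_left (by norm_num)]
    norm_num⟩

/-- The dilation `f ↦ f(·/2)` of `L²(ℝ)`. -/
def dilate : Lp ℝ 2 (volume : Measure ℝ) →L[ℝ] Lp ℝ 2 (volume : Measure ℝ) :=
  (Lp.compMeasurePreservingₗᵢ ℝ _ measurePreserving_half).toContinuousLinearMap.comp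
    (Lp.LpToLpOfMeasureLeSMul (c := 2) (by simp) le_rfl)

lemma dilate_ae (f : Lp ℝ 2 (volume : Measure ℝ)) :
    dilate f =ᵐ[volume] fun t => f (2⁻¹ * t) := by
  refine (Lp.coeFn_compMeasurePreserving _ measurePreserving_half).trans ?_
  exact measurePreserving_half.quasiMeasurePreserving.ae_eq_comp
    (Lp.coeFn_LpToLpOfMeasureLeSMul (by simp) le_rfl f)

lemma quasiMeasurePreserving_mul_left {a : ℝ} (ha : a ≠ 0) :
    Measure.QuasiMeasurePreserving (fun t : ℝ => a * t) volume volume :=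
  ⟨by fun_prop, by
    rw [Real.map_volume_mul_left ha]
    exact Measure.smul_absolutelyContinuous⟩

lemma Phi_dilate_mem (hn : 1 ≤ n) (a : Fin (4 * n + 2) × ℤ) :
    (fun t : ℝ => Phi n a.1 (2⁻¹ * t - a.2)) ∈ translateSpan n := by
  have hc := continuous_Phi hn a.1
  refine mem_translateSpan hn (by fun_prop) ?_ fun k => ?_
  · refine HasCompactSupport.intro
      (isCompact_Icc (a := 2 * ((a.2 : ℝ) - 1)) (b := 2 * ((a.2 : ℝ) + 1))) fun t ht => ?_
    rw [Phi_eq_halves, onUnit, onUnit, if_neg, if_neg, add_zero]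
    · exact fun h => ht ⟨by linarith [h.1], by linarith [h.2]⟩
    · exact fun h => ht ⟨by linarith [h.1], by linarith [h.2]⟩
  -- For t in [k,k+1) the point t/2 - a.2 lies in the half-interval with index k - 2·a.2; after
  -- dilation the knots are integers, including the midpoint knot of w.
  · obtain ⟨p, hp, h⟩ := hasRationalPieces_Phi hn a.1 (k - 2 * a.2)
    refine ⟨(p.comp (C 2⁻¹ * X + C (-(a.2 : ℚ)))).map (algebraMap ℚ ℝ), ?_, fun t ht => ?_⟩
    · rw [natDegree_map]
      exact (natDegree_comp_linear_le ..).trans hp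
    · rw [h _ ⟨by push_cast; linarith [ht.1], by push_cast; linarith [ht.2]⟩, eval_map_algebraMap,
        aeval_comp]
      simp [sub_eq_add_neg]

/-- The preimage of a closed subspace under a bounded operator is closed, so the generators suffice;
their dilates are finite combinations of translates. -/
lemma dilate_mem_V₀ (hn : 1 ≤ n) (h : ∀ i, MemLp (Phi n i) 2 (volume : Measure ℝ))
    {F : Lp ℝ 2 (volume : Measure ℝ)} (hF : F ∈ V₀ (Phi n) h) : dilate F ∈ V₀ (Phi n) h := by
  have hcl : IsClosed (((V₀ (Phi n) h).comap dilate.toLinearMap :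
      Submodule ℝ (Lp ℝ 2 (volume : Measure ℝ))) : Set (Lp ℝ 2 (volume : Measure ℝ))) :=
    (Submodule.isClosed_topologicalClosure _).preimage dilate.continuous
  refine Submodule.topologicalClosure_minimal _ (Submodule.span_le.2 ?_) hcl hF
  rintro _ ⟨a, rfl⟩
  obtain ⟨G, hG, hGe⟩ := exists_span_shifts_of_mem h (Phi_dilate_mem hn a)
  have : dilate (shifts (Phi n) h a) = G := by
    refine Lp.ext ((dilate_ae _).trans (Filter.EventuallyEq.trans ?_ hGe.symm))
    exact (quasiMeasurePreserving_mul_left (by norm_num)).ae_eq_comp (shifts_ae _ h a)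
  change dilate (shifts (Phi n) h a) ∈ V₀ (Phi n) h
  rw [this]
  exact Submodule.le_topologicalClosure _ hG

/-- If g(t) = F(2^p t), then g(t) = (dilate F)(2^(p+1) t); one inclusion at level 0 serves every p.
-/
lemma V_subset (hn : 1 ≤ n) (h : ∀ i, MemLp (Phi n i) 2 (volume : Measure ℝ)) (p : ℤ) :
    V (Phi n) h p ⊆ V (Phi n) h (p + 1) := by
  rintro g ⟨F, hF, hg⟩
  refine ⟨dilate F, dilate_mem_V₀ hn h hF, hg.trans ?_⟩
  have h2 : (2 : ℝ) ^ (p + 1) ≠ 0 := zpow_ne_zero _ (by norm_num)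
  refine Filter.EventuallyEq.symm
    (((quasiMeasurePreserving_mul_left h2).ae_eq_comp (dilate_ae F)).trans ?_)
  refine Filter.Eventually.of_forall fun t => ?_
  simp only [Function.comp]
  rw [zpow_add_one₀ (by norm_num)]
  congr 1
  ring

lemma generatesOrthogonalMRA_Phi (hn : 1 < n) : GeneratesOrthogonalMRA (Phi n) := by
  have ho : Pairwise fun a b => inner ℝ (shifts (Phi n) (memLp_Phi hn.le) a)
      (shifts (Phi n) (memLp_Phi hn.le) b) = 0 := fun a b hab => inner_shifts_Phi hn _ hab
  refine ⟨hasCompactSupport_Phi, memLp_Phi hn.le, V_subset hn.le _, ?_, rfl, fun a ha => ?_, ho⟩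
  · exact isRieszBasis_of_orthogonal ho (normSqPhi_pos hn) (norm_sq_shifts_Phi hn _)
  · have := norm_sq_shifts_Phi hn (memLp_Phi hn.le) a
    rw [ha, norm_zero] at this
    have := normSqPhi_pos hn a.1
    simp_all

end Nested

end C0MRA

end

theorem mainTheorem2 (n : ℕ) (hn : 1 < n) :
    C0MRA.GeneratesOrthogonalMRA (C0MRA.Phi n) ∧
    C0MRA.orthogonalityQuadratic (4 * n + 1) (n + 1) (2 * n) (C0MRA.alpha n : ℝ) = 0 ∧
    C0MRA.ip (C0MRA.r (4 * n + 1)) (C0MRA.l (4 * n + 1)) * C0MRA.ip (C0MRA.wn n) (C0MRA.wn n) =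
      C0MRA.ip (C0MRA.r (4 * n + 1)) (C0MRA.wn n) * C0MRA.ip (C0MRA.wn n) (C0MRA.l (4 * n + 1)) ∧
    (∀ j, Continuous (C0MRA.Phi n j)) ∧
    ∀ j, C0MRA.HasRationalPieces (4 * n + 1) (C0MRA.Phi n j) := by
  refine ⟨C0MRA.generatesOrthogonalMRA_Phi hn, C0MRA.orthogonalityQuadratic_alpha hn.le, ?_,
    C0MRA.continuous_Phi hn.le, C0MRA.hasRationalPieces_Phi hn.le⟩
  rw [C0MRA.ip_wn_l hn.le, C0MRA.ip_r_l_mul_ip_wn hn.le, sq]
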